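/- For natural numbers $a,b$ let $V_b(\mathbb{C}^a)=\{A\in\mathbb{C}^{a\times b} : A^\dagger A=\mathbb{I}_b\}$ be the complex Stiefel manifold, with the smooth structure induced from $\mathbb{C}^{a\times b}$ (as a real vector space), and let $\mathrm{U}(N)$ be the unitary group. A quantum channel $\Phi$ from $\mathcal{M}_n=\mathbb{C}^{n\times n}$ to $\mathcal{M}_m=\mathbb{C}^{m\times m}$ is a linear map which is completely positive and trace preserving; its Kraus rank is the least $r$ for which there are $m\times n$ matrices $K_1,\dots,K_r$ with $\Phi(A)=\sum_{l=1}^{r}K_lAK_l^\dagger$ for all $A\in\mathcal{M}_n$. Regard a point $K$ of $V_n(\mathbb{C}^{nm^2})$ as a column of $nm$ blocks $K_1,\dots,K_{nm}$ of size $m\times n$, and let $\pi(K)$ be the quantum channel $A\mapsto\sum_{l=1}^{nm}K_lAK_l^\dagger$. The group $\mathrm{U}(nm)$ acts on $V_n(\mathbb{C}^{nm^2})$ by $(UK)_i=\sum_{j=1}^{nm}u_{ij}K_j$. Let $\Phi$ be a quantum channel from $\mathcal{M}_n$ to $\mathcal{M}_m$ with Kraus rank $k$. Then the fibre $\pi^{-1}(\Phi)$,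 which is the $\mathrm{U}(nm)$-orbit of each of its points, is an embedded smooth submanifold of $V_n(\mathbb{C}^{nm^2})$ which is diffeomorphic to the Stiefel manifold $V_k(\mathbb{C}^{nm})$. In particular, $\pi^{-1}(\Phi)$ is diffeomorphic to $\mathrm{U}(nm)$ if and only if $k=nm$. -/

import Mathlib

set_option linter.unusedSectionVars false

open scoped Matrix ContDiff Manifold ComplexOrder

/-! ## Complex Stiefel manifolds -/

/-- The complex Stiefel manifold `V_κ(ℂ^ι)`: complex `ι × κ` matrices `A` with `A† A = 1`.
It carries the subspace topology of the space of matrices. -/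
def stiefel (ι κ : Type) [Fintype ι] [Fintype κ] [DecidableEq κ] : Set (Matrix ι κ ℂ) :=
  {A | Aᴴ * A = 1}

/-- The real dimension `2ab - b²` of `V_b(ℂ^a)`, with `a = |ι|` and `b = |κ|`
(for `b > a` the set `V_b(ℂ^a)` is empty). -/
def stiefelDim (ι κ : Type) [Fintype ι] [Fintype κ] : ℕ :=
  2 * Fintype.card ι * Fintype.card κ - Fintype.card κ ^ 2

noncomputable section StiefelCharts

variable {ι κ γ : Type} [Fintype ι] [DecidableEq ι] [Fintype κ] [DecidableEq κ]
  [Fintype γ]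

/-- `B` completes the orthonormal columns of `A` to a unitary matrix `[A B]`. -/
structure IsStiefelCompletion [DecidableEq γ] (A : Matrix ι κ ℂ) (B : Matrix ι γ ℂ) : Prop where
  left : Aᴴ * A = 1
  right : Bᴴ * B = 1
  orth : Aᴴ * B = 0
  full : A * Aᴴ + B * Bᴴ = 1

theorem stiefel_card_le (A : stiefel ι κ) : Fintype.card κ ≤ Fintype.card ι := by
  have hA : (A : Matrix ι κ ℂ)ᴴ * (A : Matrix ι κ ℂ) = 1 := A.2
  have h1 : (1 : Matrix κ κ ℂ).rank = Fintype.card κ := Matrix.rank_one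
  rw [← hA] at h1
  rw [← h1]
  exact (Matrix.rank_mul_le_right _ _).trans (Matrix.rank_le_card_height _)

theorem exists_stiefelCompletion (A : stiefel ι κ) :
    ∃ B : Matrix ι (Fin (Fintype.card ι - Fintype.card κ)) ℂ,
      IsStiefelCompletion (A : Matrix ι κ ℂ) B := by
  classical
  obtain ⟨A, hA⟩ := A
  have hle := stiefel_card_le (⟨A, hA⟩ : stiefel ι κ)
  replace hA : Aᴴ * A = 1 := hA
  let σ := κ ⊕ Fin (Fintype.card ι - Fintype.card κ)
  have hcard : Module.finrank ℂ (EuclideanSpace ℂ ι) = Fintype.card σ := by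
    simp only [finrank_euclideanSpace, σ, Fintype.card_sum, Fintype.card_fin]
    omega
  let v : σ → EuclideanSpace ℂ ι :=
    Sum.elim (fun j => WithLp.toLp 2 (fun i => A i j)) (fun _ => 0)
  have hv0 : Orthonormal ℂ (fun j : κ => v (Sum.inl j)) := by
    rw [orthonormal_iff_ite]
    intro j j'
    have := congrFun (congrFun hA j) j'
    simp only [Matrix.mul_apply, Matrix.conjTranspose_apply, Matrix.one_apply] at this
    simp only [v, Sum.elim_inl, EuclideanSpace.inner_eq_star_dotProduct, dotProduct, Pi.star_apply]
    rw [← this]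
    exact Finset.sum_congr rfl fun i _ => mul_comm _ _
  have hv : Orthonormal ℂ ((Set.range (Sum.inl : κ → σ)).domRestrict v) := by
    have := hv0.comp (Equiv.ofInjective (Sum.inl : κ → σ) Sum.inl_injective).symm
      (Equiv.injective _)
    convert this using 1
    funext ⟨_, j, rfl⟩
    simp
  obtain ⟨b, hb⟩ := hv.exists_orthonormalBasis_extension_of_card_eq hcard
  let C : Matrix ι σ ℂ := Matrix.of fun i s => b s i
  have hC : Cᴴ * C = 1 := by
    ext s t
    have := (orthonormal_iff_ite.mp b.orthonormal) s t
    simp only [EuclideanSpace.inner_eq_star_dotProduct, dotProduct, Pi.star_apply] at this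
    simp only [Matrix.mul_apply, Matrix.conjTranspose_apply, Matrix.one_apply, C, Matrix.of_apply]
    rw [← this]
    exact Finset.sum_congr rfl fun i _ => mul_comm _ _
  have hcard' : Fintype.card ι = Fintype.card σ := by
    rw [← hcard, finrank_euclideanSpace]
  have hC' : C * Cᴴ = 1 := (Matrix.mul_eq_one_comm_of_card_eq _ _ _ hcard').mpr hC
  have hCA : ∀ i j, C i (Sum.inl j) = A i j := by
    intro i j
    simp [C, hb (Sum.inl j) ⟨j, rfl⟩, v]
  refine ⟨Matrix.of fun i s => C i (Sum.inr s), hA, ?_, ?_, ?_⟩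
  · ext s t
    have := congrFun (congrFun hC (Sum.inr s)) (Sum.inr t)
    simpa [Matrix.mul_apply, Matrix.one_apply] using this
  · ext s t
    have := congrFun (congrFun hC (Sum.inl s)) (Sum.inr t)
    simpa [Matrix.mul_apply, Matrix.one_apply, hCA] using this
  · ext s t
    have := congrFun (congrFun hC' s) t
    simpa [Matrix.mul_apply, Matrix.one_apply, Fintype.sum_sum_type, hCA, σ] using this

/-- Cayley coordinates around `A`: the matrix `[A B]† Z = (T ; P)` is sent to the pair
`X = (1+T)⁻¹† (T - T†) (1+T)⁻¹` (skew-Hermitian), `Y = P (1+T)⁻¹`. -/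
def cayleyCoord (A : Matrix ι κ ℂ) (B : Matrix ι γ ℂ) (Z : Matrix ι κ ℂ) :
    Matrix κ κ ℂ × Matrix γ κ ℂ :=
  (((1 + Aᴴ * Z)⁻¹)ᴴ * (Aᴴ * Z - (Aᴴ * Z)ᴴ) * (1 + Aᴴ * Z)⁻¹, Bᴴ * Z * (1 + Aᴴ * Z)⁻¹)

/-- The denominator of the inverse Cayley coordinates. -/
def cayleyDen (p : Matrix κ κ ℂ × Matrix γ κ ℂ) : Matrix κ κ ℂ :=
  1 - p.1 + p.2ᴴ * p.2

/-- The inverse Cayley coordinates around `A`. -/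
def cayleyInv (A : Matrix ι κ ℂ) (B : Matrix ι γ ℂ) (p : Matrix κ κ ℂ × Matrix γ κ ℂ) :
    Matrix ι κ ℂ :=
  A * ((2 : ℂ) • (cayleyDen p)⁻¹ - 1) + B * p.2 * ((2 : ℂ) • (cayleyDen p)⁻¹)

theorem cayleyCoord_skew (A : Matrix ι κ ℂ) (B : Matrix ι γ ℂ) (Z : Matrix ι κ ℂ) :
    (cayleyCoord A B Z).1 ∈ skewAdjoint.submodule ℝ (Matrix κ κ ℂ) := by
  change star _ = -_
  simp only [cayleyCoord, Matrix.star_eq_conjTranspose, Matrix.conjTranspose_mul,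
    Matrix.conjTranspose_sub, Matrix.conjTranspose_conjTranspose]
  noncomm_ring

theorem isUnit_cayleyDen (p : Matrix κ κ ℂ × Matrix γ κ ℂ) (hp : p.1ᴴ = -p.1) :
    IsUnit (cayleyDen p).det := by
  rw [isUnit_iff_ne_zero]
  intro h0
  obtain ⟨v, hv, hv0⟩ := Matrix.exists_mulVec_eq_zero_iff.mpr h0
  have hpd : (1 + p.2ᴴ * p.2).PosDef :=
    Matrix.PosDef.one.add_posSemidef (Matrix.posSemidef_conjTranspose_mul_self _)
  have hpos := hpd.dotProduct_mulVec_pos hv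
  have e1 : (1 + p.2ᴴ * p.2) = ((1 / 2 : ℂ)) • (cayleyDen p + (cayleyDen p)ᴴ) := by
    simp only [cayleyDen, Matrix.conjTranspose_add, Matrix.conjTranspose_sub, hp,
      Matrix.conjTranspose_one, Matrix.conjTranspose_mul, Matrix.conjTranspose_conjTranspose]
    module
  have e2 : star v ⬝ᵥ ((cayleyDen p)ᴴ *ᵥ v) = 0 := by
    rw [Matrix.dotProduct_mulVec, ← Matrix.star_mulVec, hv0]
    simp
  rw [e1, Matrix.smul_mulVec, Matrix.add_mulVec, hv0] at hpos
  simp [e2] at hpos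

variable [DecidableEq γ]

theorem cayleyInv_coord {A : Matrix ι κ ℂ} {B : Matrix ι γ ℂ} (h : IsStiefelCompletion A B)
    {Z : Matrix ι κ ℂ} (hZ : Zᴴ * Z = 1) (hd : IsUnit (1 + Aᴴ * Z).det) :
    cayleyInv A B (cayleyCoord A B Z) = Z := by
  have hTP : (Aᴴ * Z)ᴴ * (Aᴴ * Z) + (Bᴴ * Z)ᴴ * (Bᴴ * Z) = 1 := by
    rw [← hZ, Matrix.conjTranspose_mul, Matrix.conjTranspose_mul, Matrix.conjTranspose_conjTranspose,
      Matrix.conjTranspose_conjTranspose]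
    calc _ = Zᴴ * (A * Aᴴ + B * Bᴴ) * Z := by
            simp only [Matrix.mul_add, Matrix.add_mul, Matrix.mul_assoc]
      _ = _ := by rw [h.full, Matrix.mul_one]
  have hZd : A * (Aᴴ * Z) + B * (Bᴴ * Z) = Z := by
    rw [← Matrix.mul_assoc, ← Matrix.mul_assoc, ← Matrix.add_mul, h.full, Matrix.one_mul]
  have hden : cayleyDen (cayleyCoord A B Z) * (1 + Aᴴ * Z) = (2 : ℂ) • 1 := by
    simp only [cayleyDen, cayleyCoord]
    generalize Aᴴ * Z = T at *
    generalize Bᴴ * Z = P at *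
    have hG : (1 + T)⁻¹ * (1 + T) = 1 := Matrix.nonsing_inv_mul _ hd
    have hG' : (1 + T)ᴴ * ((1 + T)⁻¹)ᴴ = 1 := by
      rw [← Matrix.conjTranspose_mul, hG, Matrix.conjTranspose_one]
    have hu : IsUnit (1 + T)ᴴ.det := by
      rw [Matrix.det_conjTranspose]; exact hd.star
    have key : (1 + T)ᴴ * ((1 - ((1 + T)⁻¹)ᴴ * (T - Tᴴ) * (1 + T)⁻¹
        + (P * (1 + T)⁻¹)ᴴ * (P * (1 + T)⁻¹)) * (1 + T)) = (1 + T)ᴴ * ((2 : ℂ) • 1) := by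
      calc _ = (1 + T)ᴴ * (1 + T)
            - ((1 + T)ᴴ * ((1 + T)⁻¹)ᴴ) * (T - Tᴴ) * ((1 + T)⁻¹ * (1 + T))
            + ((1 + T)ᴴ * ((1 + T)⁻¹)ᴴ) * Pᴴ * P * ((1 + T)⁻¹ * (1 + T)) := by
              generalize (1 + T)⁻¹ = G
              generalize 1 + T = W
              simp only [Matrix.conjTranspose_mul, Matrix.mul_add, Matrix.add_mul, Matrix.mul_sub,
                Matrix.sub_mul, Matrix.mul_assoc, Matrix.one_mul]
        _ = (1 + T)ᴴ * (1 + T) - (T - Tᴴ) + Pᴴ * P := by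
              rw [hG, hG']; simp
        _ = 1 + T + Tᴴ - (T - Tᴴ) + (Tᴴ * T + Pᴴ * P) := by
              rw [Matrix.conjTranspose_add, Matrix.conjTranspose_one]; noncomm_ring
        _ = _ := by
              rw [hTP, Matrix.conjTranspose_add, Matrix.conjTranspose_one, Matrix.mul_smul,
                Matrix.mul_one]
              module
    have := congrArg (fun W => ((1 + T)ᴴ)⁻¹ * W) key
    simpa only [← Matrix.mul_assoc, Matrix.nonsing_inv_mul _ hu, Matrix.one_mul] using this
  have hinv : (cayleyDen (cayleyCoord A B Z))⁻¹ = (1 / 2 : ℂ) • (1 + Aᴴ * Z) := by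
    apply Matrix.inv_eq_right_inv
    rw [Matrix.mul_smul, hden, smul_smul]; norm_num
  have h2 : (2 : ℂ) • (cayleyDen (cayleyCoord A B Z))⁻¹ = 1 + Aᴴ * Z := by
    rw [hinv, smul_smul]; norm_num
  rw [cayleyInv, h2]
  have : (cayleyCoord A B Z).2 * (1 + Aᴴ * Z) = Bᴴ * Z := by
    simp only [cayleyCoord]
    rw [Matrix.mul_assoc, Matrix.nonsing_inv_mul _ hd, Matrix.mul_one]
  rw [Matrix.mul_assoc, this, add_sub_cancel_left, hZd]

theorem cayleyInv_spec {A : Matrix ι κ ℂ} {B : Matrix ι γ ℂ} (h : IsStiefelCompletion A B)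
    (p : Matrix κ κ ℂ × Matrix γ κ ℂ) (hp : p.1ᴴ = -p.1) :
    (cayleyInv A B p)ᴴ * cayleyInv A B p = 1 ∧ IsUnit (1 + Aᴴ * cayleyInv A B p).det ∧
      cayleyCoord A B (cayleyInv A B p) = p := by
  have hu := isUnit_cayleyDen p hp
  have hBA : Bᴴ * A = 0 := by
    have := congrArg Matrix.conjTranspose h.orth
    simpa [Matrix.conjTranspose_mul] using this
  obtain ⟨X, Y⟩ := p
  simp only at hp
  have hN1 := Matrix.mul_nonsing_inv _ hu
  have hN2 := Matrix.nonsing_inv_mul _ hu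
  have hsum : cayleyDen (X, Y) + (cayleyDen (X, Y))ᴴ = (2 : ℂ) • (1 + Yᴴ * Y) := by
    simp only [cayleyDen, Matrix.conjTranspose_add, Matrix.conjTranspose_sub, hp,
      Matrix.conjTranspose_one, Matrix.conjTranspose_mul, Matrix.conjTranspose_conjTranspose]
    module
  have hdiff : (cayleyDen (X, Y))ᴴ - cayleyDen (X, Y) = (2 : ℂ) • X := by
    simp only [cayleyDen, Matrix.conjTranspose_add, Matrix.conjTranspose_sub, hp,
      Matrix.conjTranspose_one, Matrix.conjTranspose_mul, Matrix.conjTranspose_conjTranspose]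
    module
  simp only [cayleyInv]
  generalize cayleyDen (X, Y) = N at *
  obtain ⟨M, hM⟩ : ∃ M : Matrix κ κ ℂ, M = (2 : ℂ) • N⁻¹ := ⟨_, rfl⟩
  rw [← hM]
  have hNM : N * M = (2 : ℂ) • 1 := by rw [hM, Matrix.mul_smul, hN1]
  have hMN : M * N = (2 : ℂ) • 1 := by rw [hM, Matrix.smul_mul, hN2]
  have hMN' : Mᴴ * Nᴴ = (2 : ℂ) • 1 := by
    rw [← Matrix.conjTranspose_mul, hNM]; simp
  have hT : Aᴴ * (A * (M - 1) + B * Y * M) = M - 1 := by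
    rw [Matrix.mul_add, ← Matrix.mul_assoc, h.left, Matrix.mul_assoc B, ← Matrix.mul_assoc Aᴴ,
      h.orth]
    simp
  have hP : Bᴴ * (A * (M - 1) + B * Y * M) = Y * M := by
    rw [Matrix.mul_add, ← Matrix.mul_assoc, hBA, Matrix.mul_assoc B, ← Matrix.mul_assoc Bᴴ,
      h.right]
    simp
  have hMinv : M⁻¹ = (1 / 2 : ℂ) • N := by
    apply Matrix.inv_eq_right_inv
    rw [Matrix.mul_smul, hMN, smul_smul]; norm_num
  have hMu : IsUnit M.det := by
    rw [← Matrix.isUnit_iff_isUnit_det]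
    refine IsUnit.of_mul_eq_one ((1 / 2 : ℂ) • N) ?_
    rw [Matrix.mul_smul, hMN, smul_smul]; norm_num
  have hMM := Matrix.mul_nonsing_inv _ hMu
  have hMM2 := Matrix.nonsing_inv_mul _ hMu
  refine ⟨?_, ?_, ?_⟩
  · have hq : Mᴴ * (1 + Yᴴ * Y) * M = M + Mᴴ := by
      have : (1 + Yᴴ * Y) = (1 / 2 : ℂ) • (N + Nᴴ) := by
        rw [hsum, smul_smul]; norm_num
      rw [this, Matrix.mul_smul, Matrix.smul_mul, Matrix.mul_add, Matrix.add_mul, hMN',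
        Matrix.mul_assoc Mᴴ, hNM]
      simp only [Matrix.mul_smul, Matrix.smul_mul, Matrix.mul_one, Matrix.one_mul]
      module
    calc _ = (M - 1)ᴴ * (Aᴴ * (A * (M - 1) + B * Y * M))
          + (Y * M)ᴴ * (Bᴴ * (A * (M - 1) + B * Y * M)) := by
            rw [Matrix.conjTranspose_add, Matrix.add_mul]
            simp only [Matrix.conjTranspose_mul, Matrix.mul_assoc]
      _ = (M - 1)ᴴ * (M - 1) + (Y * M)ᴴ * (Y * M) := by rw [hT, hP]
      _ = Mᴴ * (1 + Yᴴ * Y) * M - M - Mᴴ + 1 := by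
            simp only [Matrix.conjTranspose_sub, Matrix.conjTranspose_one,
              Matrix.conjTranspose_mul, Matrix.mul_add, Matrix.add_mul, Matrix.mul_sub,
              Matrix.sub_mul, Matrix.mul_assoc, Matrix.mul_one, Matrix.one_mul]
            abel
      _ = 1 := by rw [hq]; abel
  · rw [hT, add_sub_cancel]; exact hMu
  · simp only [cayleyCoord]
    rw [hT, hP, add_sub_cancel]
    have hMMH : (M⁻¹)ᴴ * Mᴴ = 1 := by
      rw [← Matrix.conjTranspose_mul, hMM, Matrix.conjTranspose_one]
    refine Prod.ext ?_ ?_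
    · change (M⁻¹)ᴴ * (M - 1 - (M - 1)ᴴ) * M⁻¹ = X
      calc _ = (M⁻¹)ᴴ * (M * M⁻¹) - ((M⁻¹)ᴴ * Mᴴ) * M⁻¹ := by
            simp only [Matrix.conjTranspose_sub, Matrix.conjTranspose_one, Matrix.mul_sub,
              Matrix.sub_mul, Matrix.mul_assoc, Matrix.mul_one]
            abel
        _ = (M⁻¹)ᴴ - M⁻¹ := by rw [hMM, hMMH]; simp
        _ = (1 / 2 : ℂ) • (Nᴴ - N) := by
            rw [hMinv, Matrix.conjTranspose_smul]
            simp only [smul_sub]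
            congr 2
            simp
        _ = X := by rw [hdiff, smul_smul]; norm_num
    · change Y * M * M⁻¹ = Y
      rw [Matrix.mul_assoc, hMM, Matrix.mul_one]

theorem finrank_cayleyModel (h : Fintype.card κ ≤ Fintype.card ι) :
    Module.finrank ℝ (skewAdjoint.submodule ℝ (Matrix κ κ ℂ) ×
      Matrix (Fin (Fintype.card ι - Fintype.card κ)) κ ℂ) = stiefelDim ι κ := by
  have h1 : Module.finrank ℝ (skewAdjoint.submodule ℝ (Matrix κ κ ℂ)) =
      Module.finrank ℝ (selfAdjoint.submodule ℝ (Matrix κ κ ℂ)) := by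
    apply LinearEquiv.finrank_eq
    refine LinearEquiv.ofBijective (skewAdjoint.negISMul (A := Matrix κ κ ℂ)) ⟨?_, ?_⟩
    · intro a b hab
      apply Subtype.ext
      rw [← skewAdjoint.I_smul_neg_I a, ← skewAdjoint.I_smul_neg_I b, hab]
    · intro a
      have ha : (a : Matrix κ κ ℂ) = star (a : Matrix κ κ ℂ) := a.2.star_eq.symm
      refine ⟨⟨Complex.I • (a : Matrix κ κ ℂ), ?_⟩, ?_⟩
      · change star _ = -_
        rw [star_smul, ← ha]
        simp
      · apply Subtype.ext
        simp [smul_smul]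
  have h2 : Module.finrank ℝ (Matrix κ κ ℂ) =
      Module.finrank ℝ (selfAdjoint.submodule ℝ (Matrix κ κ ℂ)) +
      Module.finrank ℝ (skewAdjoint.submodule ℝ (Matrix κ κ ℂ)) := by
    rw [← Module.finrank_prod]
    exact LinearEquiv.finrank_eq (StarModule.decomposeProdAdjoint ℝ (Matrix κ κ ℂ))
  rw [Module.finrank_matrix, Complex.finrank_real_complex] at h2
  rw [Module.finrank_prod, Module.finrank_matrix, Complex.finrank_real_complex, stiefelDim,
    Fintype.card_fin]
  have h3 : Module.finrank ℝ (skewAdjoint.submodule ℝ (Matrix κ κ ℂ)) = Fintype.card κ ^ 2 := by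
    nlinarith
  rw [h3]
  obtain ⟨c, hc⟩ := Nat.exists_eq_add_of_le h
  rw [hc, Nat.add_sub_cancel_left]
  symm
  apply Nat.sub_eq_of_eq_add
  ring

variable (ι κ) in
/-- A linear identification of the space of Cayley coordinates with `ℝ^d`. -/
def cayleyModel (h : Fintype.card κ ≤ Fintype.card ι) :
    (skewAdjoint.submodule ℝ (Matrix κ κ ℂ) ×
      Matrix (Fin (Fintype.card ι - Fintype.card κ)) κ ℂ) ≃ₗ[ℝ]
      EuclideanSpace ℝ (Fin (stiefelDim ι κ)) :=
  LinearEquiv.ofFinrankEq _ _ (by rw [finrank_cayleyModel h, finrank_euclideanSpace_fin])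

/-- `cayleyModel`, extended linearly to all pairs of matrices. -/
def cayleyModelExt (h : Fintype.card κ ≤ Fintype.card ι) :
    (Matrix κ κ ℂ × Matrix (Fin (Fintype.card ι - Fintype.card κ)) κ ℂ) →ₗ[ℝ]
      EuclideanSpace ℝ (Fin (stiefelDim ι κ)) :=
  (cayleyModel ι κ h).toLinearMap ∘ₗ
    ((skewAdjointPart ℝ (A := Matrix κ κ ℂ)).prodMap LinearMap.id)

/-- The inverse of `cayleyModel`, as a map to pairs of matrices. -/
def cayleyModelInv (h : Fintype.card κ ≤ Fintype.card ι) :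
    EuclideanSpace ℝ (Fin (stiefelDim ι κ)) →ₗ[ℝ]
    (Matrix κ κ ℂ × Matrix (Fin (Fintype.card ι - Fintype.card κ)) κ ℂ) :=
  ((skewAdjoint.submodule ℝ (Matrix κ κ ℂ)).subtype.prodMap LinearMap.id) ∘ₗ
    (cayleyModel ι κ h).symm.toLinearMap

theorem cayleyModelInv_skew (h : Fintype.card κ ≤ Fintype.card ι)
    (x : EuclideanSpace ℝ (Fin (stiefelDim ι κ))) :
    (cayleyModelInv h x).1ᴴ = -(cayleyModelInv h x).1 :=
  ((cayleyModel ι κ h).symm x).1.2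

theorem cayleyModelExt_inv (h : Fintype.card κ ≤ Fintype.card ι)
    (x : EuclideanSpace ℝ (Fin (stiefelDim ι κ))) :
    cayleyModelExt h (cayleyModelInv h x) = x := by
  have h1 : (skewAdjointPart ℝ (A := Matrix κ κ ℂ)) ((cayleyModel ι κ h).symm x).1.1 =
      ((cayleyModel ι κ h).symm x).1 :=
    LinearMap.congr_fun (skewAdjointPart_comp_subtype_skewAdjoint (A := Matrix κ κ ℂ) ℝ)
      ((cayleyModel ι κ h).symm x).1
  change (cayleyModel ι κ h) ((skewAdjointPart ℝ (A := Matrix κ κ ℂ))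
    ((cayleyModel ι κ h).symm x).1.1, ((cayleyModel ι κ h).symm x).2) = x
  rw [h1]
  exact (cayleyModel ι κ h).apply_symm_apply x

theorem cayleyModelInv_ext (h : Fintype.card κ ≤ Fintype.card ι)
    (p : Matrix κ κ ℂ × Matrix (Fin (Fintype.card ι - Fintype.card κ)) κ ℂ)
    (hp : p.1 ∈ skewAdjoint.submodule ℝ (Matrix κ κ ℂ)) :
    cayleyModelInv h (cayleyModelExt h p) = p := by
  have h1 : (skewAdjointPart ℝ (A := Matrix κ κ ℂ)) p.1 = ⟨p.1, hp⟩ :=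
    LinearMap.congr_fun (skewAdjointPart_comp_subtype_skewAdjoint (A := Matrix κ κ ℂ) ℝ)
      ⟨p.1, hp⟩
  have h2 : (cayleyModel ι κ h).symm (cayleyModelExt h p) = (⟨p.1, hp⟩, p.2) := by
    change (cayleyModel ι κ h).symm ((cayleyModel ι κ h)
      ((skewAdjointPart ℝ (A := Matrix κ κ ℂ)) p.1, p.2)) = _
    rw [h1]
    exact (cayleyModel ι κ h).symm_apply_apply _
  change ((((cayleyModel ι κ h).symm (cayleyModelExt h p)).1 : Matrix κ κ ℂ),
    ((cayleyModel ι κ h).symm (cayleyModelExt h p)).2) = p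
  rw [h2]

/-! ### The coordinate changes are smooth -/

section Smooth

attribute [local instance] Matrix.normedAddCommGroup Matrix.normedSpace

variable {V : Type*} [NormedAddCommGroup V] [NormedSpace ℝ V] {s : Set V} {r : ℕ∞ω}
  {α β δ : Type} [Fintype α] [Fintype β] [Fintype δ]

theorem contDiffOn_matrix {f : V → Matrix α β ℂ} :
    ContDiffOn ℝ r f s ↔ ∀ i j, ContDiffOn ℝ r (fun x => f x i j) s :=
  contDiffOn_pi.trans (forall_congr' fun _ => contDiffOn_pi)

theorem ContDiffOn.matrixMul {f : V → Matrix α β ℂ} {g : V → Matrix β δ ℂ}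
    (hf : ContDiffOn ℝ r f s) (hg : ContDiffOn ℝ r g s) :
    ContDiffOn ℝ r (fun x => f x * g x) s := by
  rw [contDiffOn_matrix] at *
  intro i j
  simp only [Matrix.mul_apply]
  exact ContDiffOn.sum fun k _ => (hf i k).mul (hg k j)

theorem ContDiffOn.matrixConjTranspose {f : V → Matrix α β ℂ} (hf : ContDiffOn ℝ r f s) :
    ContDiffOn ℝ r (fun x => (f x)ᴴ) s := by
  rw [contDiffOn_matrix] at *
  intro i j
  exact Complex.conjCLE.contDiff.comp_contDiffOn (hf j i)

theorem ContDiffOn.matrixDet [DecidableEq α] {f : V → Matrix α α ℂ} (hf : ContDiffOn ℝ r f s) :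
    ContDiffOn ℝ r (fun x => (f x).det) s := by
  rw [contDiffOn_matrix] at hf
  simp only [Matrix.det_apply]
  exact ContDiffOn.sum fun σ _ => (contDiffOn_prod fun i _ => hf (σ i) i).const_smul _

theorem ContDiffOn.matrixInv [DecidableEq α] {f : V → Matrix α α ℂ} (hf : ContDiffOn ℝ r f s)
    (h : ∀ x ∈ s, IsUnit (f x).det) : ContDiffOn ℝ r (fun x => (f x)⁻¹) s := by
  have h1 : ContDiffOn ℝ r (fun x => ((f x).det)⁻¹) s :=
    hf.matrixDet.inv fun x hx => (h x hx).ne_zero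
  rw [contDiffOn_matrix]
  intro i j
  simp only [Matrix.inv_def, Matrix.smul_apply, smul_eq_mul, Ring.inverse_eq_inv',
    Matrix.adjugate_apply]
  refine h1.mul (ContDiffOn.matrixDet ?_)
  rw [contDiffOn_matrix] at *
  intro a b
  by_cases hab : a = j
  · subst hab
    simpa using contDiffOn_const
  · simpa [Matrix.updateRow_ne hab] using hf a b

theorem contDiffOn_cayleyCoord (A : Matrix ι κ ℂ) (B : Matrix ι γ ℂ) {f : V → Matrix ι κ ℂ}
    (hf : ContDiffOn ℝ r f s) (h : ∀ x ∈ s, IsUnit (1 + Aᴴ * f x).det) :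
    ContDiffOn ℝ r (fun x => cayleyCoord A B (f x)) s := by
  have hT : ContDiffOn ℝ r (fun x => Aᴴ * f x) s := contDiffOn_const.matrixMul hf
  have hP : ContDiffOn ℝ r (fun x => Bᴴ * f x) s := contDiffOn_const.matrixMul hf
  have hG : ContDiffOn ℝ r (fun x => (1 + Aᴴ * f x)⁻¹) s :=
    (contDiffOn_const.add hT).matrixInv h
  exact ((hG.matrixConjTranspose.matrixMul (hT.sub hT.matrixConjTranspose)).matrixMul hG).prodMk
    (hP.matrixMul hG)

theorem contDiffOn_cayleyInv (A : Matrix ι κ ℂ) (B : Matrix ι γ ℂ)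
    {f : V → Matrix κ κ ℂ × Matrix γ κ ℂ}
    (hf : ContDiffOn ℝ r f s) (h : ∀ x ∈ s, (f x).1ᴴ = -(f x).1) :
    ContDiffOn ℝ r (fun x => cayleyInv A B (f x)) s := by
  have hD : ContDiffOn ℝ r (fun x => (2 : ℂ) • (cayleyDen (f x))⁻¹) s :=
    (ContDiffOn.matrixInv ((contDiffOn_const.sub hf.fst).add
      (hf.snd.matrixConjTranspose.matrixMul hf.snd))
      fun x hx => isUnit_cayleyDen _ (h x hx)).const_smul _
  exact (contDiffOn_const.matrixMul (hD.sub contDiffOn_const)).add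
    ((contDiffOn_const.matrixMul hf.snd).matrixMul hD)

theorem contDiff_cayleyModelExt (h : Fintype.card κ ≤ Fintype.card ι) :
    ContDiff ℝ r (cayleyModelExt (ι := ι) (κ := κ) h) :=
  (LinearMap.toContinuousLinearMap (cayleyModelExt (ι := ι) (κ := κ) h)).contDiff

theorem contDiff_cayleyModelInv (h : Fintype.card κ ≤ Fintype.card ι) :
    ContDiff ℝ r (cayleyModelInv (ι := ι) (κ := κ) h) :=
  (LinearMap.toContinuousLinearMap (cayleyModelInv (ι := ι) (κ := κ) h)).contDiff

end Smooth

/-! ### The smooth structure of the Stiefel manifold -/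

/-- A chosen unitary completion of `A`. -/
def stiefelCompletion (A : stiefel ι κ) : Matrix ι (Fin (Fintype.card ι - Fintype.card κ)) ℂ :=
  (exists_stiefelCompletion A).choose

theorem stiefelCompletion_spec (A : stiefel ι κ) :
    IsStiefelCompletion (A : Matrix ι κ ℂ) (stiefelCompletion A) :=
  (exists_stiefelCompletion A).choose_spec

/-- The formula for the chart around `A`, on all matrices. -/
def stiefelChartFun (A : stiefel ι κ) (Z : Matrix ι κ ℂ) :
    EuclideanSpace ℝ (Fin (stiefelDim ι κ)) :=
  cayleyModelExt (stiefel_card_le A) (cayleyCoord A.1 (stiefelCompletion A) Z)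

/-- The formula for the inverse of the chart around `A`. -/
def stiefelChartInv (A : stiefel ι κ) (x : EuclideanSpace ℝ (Fin (stiefelDim ι κ))) :
    Matrix ι κ ℂ :=
  cayleyInv A.1 (stiefelCompletion A) (cayleyModelInv (stiefel_card_le A) x)

section Smooth

attribute [local instance] Matrix.normedAddCommGroup Matrix.normedSpace

theorem contDiffOn_stiefelChartFun {r : ℕ∞ω} (A : stiefel ι κ) :
    ContDiffOn ℝ r (stiefelChartFun A) {Z | IsUnit (1 + (A : Matrix ι κ ℂ)ᴴ * Z).det} :=
  (contDiff_cayleyModelExt _).comp_contDiffOn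
    (contDiffOn_cayleyCoord _ _ contDiffOn_id fun _ hx => hx)

theorem contDiff_stiefelChartInv {r : ℕ∞ω} (A : stiefel ι κ) :
    ContDiff ℝ r (stiefelChartInv A) :=
  contDiffOn_univ.mp (contDiffOn_cayleyInv _ _ (contDiff_cayleyModelInv _).contDiffOn
    fun _ _ => cayleyModelInv_skew _ _)

theorem continuousOn_stiefelChartFun (A : stiefel ι κ) :
    ContinuousOn (stiefelChartFun A) {Z | IsUnit (1 + (A : Matrix ι κ ℂ)ᴴ * Z).det} :=
  (contDiffOn_stiefelChartFun (r := 0) A).continuousOn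

theorem continuous_stiefelChartInv (A : stiefel ι κ) : Continuous (stiefelChartInv A) :=
  (contDiff_stiefelChartInv (r := 0) A).continuous

end Smooth

/-- The domain of the chart around `A`. -/
def stiefelChartSource (A : stiefel ι κ) : Set (Matrix ι κ ℂ) :=
  {Z | IsUnit (1 + (A : Matrix ι κ ℂ)ᴴ * Z).det}

theorem isOpen_stiefelChartSource (A : stiefel ι κ) : IsOpen (stiefelChartSource A) := by
  have : Continuous fun Z : Matrix ι κ ℂ => (1 + (A : Matrix ι κ ℂ)ᴴ * Z).det := by fun_prop
  simp only [stiefelChartSource, isUnit_iff_ne_zero]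
  exact isOpen_ne.preimage this

/-- The Cayley chart of the Stiefel manifold around `A`. Its domain is
`{Z | det (1 + A† Z) ≠ 0}`, and its image is the whole of `ℝ^d`. -/
def stiefelChart (A : stiefel ι κ) :
    OpenPartialHomeomorph (stiefel ι κ) (EuclideanSpace ℝ (Fin (stiefelDim ι κ))) where
  toFun Z := stiefelChartFun A Z
  invFun x := ⟨stiefelChartInv A x,
    (cayleyInv_spec (stiefelCompletion_spec A) _ (cayleyModelInv_skew _ x)).1⟩
  source := Subtype.val ⁻¹' stiefelChartSource A
  target := Set.univ
  map_source' _ _ := Set.mem_univ _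
  map_target' x _ :=
    (cayleyInv_spec (stiefelCompletion_spec A) _ (cayleyModelInv_skew _ x)).2.1
  left_inv' Z hZ := by
    apply Subtype.ext
    simp only [stiefelChartFun, stiefelChartInv]
    rw [cayleyModelInv_ext _ _ (cayleyCoord_skew _ _ _)]
    exact cayleyInv_coord (stiefelCompletion_spec A) Z.2 hZ
  right_inv' x _ := by
    simp only [stiefelChartFun, stiefelChartInv]
    rw [(cayleyInv_spec (stiefelCompletion_spec A) _ (cayleyModelInv_skew _ x)).2.2,
      cayleyModelExt_inv]
  open_source := (isOpen_stiefelChartSource A).preimage continuous_subtype_val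
  open_target := isOpen_univ
  continuousOn_toFun :=
    (continuousOn_stiefelChartFun A).comp continuous_subtype_val.continuousOn fun _ hZ => hZ
  continuousOn_invFun := ((continuous_stiefelChartInv A).subtype_mk _).continuousOn

theorem mem_stiefelChart_source (A : stiefel ι κ) : A ∈ (stiefelChart A).source := by
  change IsUnit (1 + (A : Matrix ι κ ℂ)ᴴ * (A : Matrix ι κ ℂ)).det
  have hA : (A : Matrix ι κ ℂ)ᴴ * (A : Matrix ι κ ℂ) = 1 := A.2
  rw [hA, one_add_one_eq_two, ← Matrix.isUnit_iff_isUnit_det]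
  exact IsUnit.mk0 (2 : ℂ) two_ne_zero |>.map (algebraMap ℂ (Matrix κ κ ℂ))

/-- The smooth structure of the Stiefel manifold, given by the Cayley charts. -/
instance stiefelChartedSpace :
    ChartedSpace (EuclideanSpace ℝ (Fin (stiefelDim ι κ))) (stiefel ι κ) where
  atlas := Set.range stiefelChart
  chartAt := stiefelChart
  mem_chart_source := mem_stiefelChart_source
  chart_mem_atlas := Set.mem_range_self

theorem contDiffOn_stiefel_transition (A A' : stiefel ι κ) :
    ContDiffOn ℝ ∞ (fun x => stiefelChartFun A' (stiefelChartInv A x))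
      {x | IsUnit (1 + (A' : Matrix ι κ ℂ)ᴴ * stiefelChartInv A x).det} := by
  let _ := Matrix.normedAddCommGroup (m := ι) (n := κ) (α := ℂ)
  let _ := Matrix.normedSpace (m := ι) (n := κ) (R := ℝ) (α := ℂ)
  exact (contDiffOn_stiefelChartFun A').comp (contDiff_stiefelChartInv A).contDiffOn
    fun _ hx => hx

instance stiefelIsManifold : IsManifold (𝓡 (stiefelDim ι κ)) ∞ (stiefel ι κ) := by
  apply isManifold_of_contDiffOn
  rintro _ _ ⟨A, rfl⟩ ⟨A', rfl⟩
  refine (contDiffOn_stiefel_transition A A').mono ?_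
  rintro x ⟨hx, -⟩
  exact hx.2

/-! The smooth structure is the one induced from the space of matrices: the inclusion is smooth,
and a continuous map into the Stiefel manifold is smooth as soon as it is smooth as a
matrix-valued map. -/

section Smooth

attribute [local instance] Matrix.normedAddCommGroup Matrix.normedSpace

theorem contMDiff_stiefel_coe :
    ContMDiff (𝓡 (stiefelDim ι κ)) 𝓘(ℝ, ι → κ → ℂ) ∞
      (fun (A : stiefel ι κ) i j => (A : Matrix ι κ ℂ) i j) := by
  intro A
  rw [contMDiffAt_iff]
  refine ⟨Continuous.continuousAt ?_, ?_⟩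
  · exact continuous_subtype_val (p := fun A : Matrix ι κ ℂ => A ∈ stiefel ι κ)
  · exact (contDiff_stiefelChartInv A).contDiffAt.contDiffWithinAt

theorem contMDiff_stiefel_iff {E H M : Type*} [NormedAddCommGroup E] [NormedSpace ℝ E]
    [TopologicalSpace H] {I : ModelWithCorners ℝ E H} [TopologicalSpace M] [ChartedSpace H M]
    {f : M → stiefel ι κ} :
    ContMDiff I (𝓡 (stiefelDim ι κ)) ∞ f ↔
      ContMDiff I 𝓘(ℝ, ι → κ → ℂ) ∞ (fun x i j => (f x : Matrix ι κ ℂ) i j) := by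
  refine ⟨fun h => contMDiff_stiefel_coe.comp h, fun h x => ?_⟩
  rw [contMDiffAt_iff_target]
  refine ⟨(continuous_induced_rng.mpr (h.continuous :)).continuousAt, ?_⟩
  have h1 : ContMDiffAt 𝓘(ℝ, ι → κ → ℂ) 𝓘(ℝ, EuclideanSpace ℝ (Fin (stiefelDim ι κ))) ∞
      (fun Z : ι → κ → ℂ => stiefelChartFun (f x) Z) (fun i j => (f x : Matrix ι κ ℂ) i j) :=
    ContDiffAt.contMDiffAt ((contDiffOn_stiefelChartFun (f x)).contDiffAt
      ((isOpen_stiefelChartSource (f x)).mem_nhds (mem_stiefelChart_source (f x))))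
  exact ContMDiffAt.comp (f := fun x i j => (f x : Matrix ι κ ℂ) i j) x h1 (h x)

end Smooth

/-! ### The smooth structure of the unitary group -/

variable (ι) in
/-- The unitary group is the Stiefel manifold of square matrices. -/
def unitaryHomeomorph : Matrix.unitaryGroup ι ℂ ≃ₜ stiefel ι ι where
  toFun U := ⟨U, Matrix.mem_unitaryGroup_iff'.mp U.2⟩
  invFun A := ⟨A, Matrix.mem_unitaryGroup_iff'.mpr A.2⟩
  left_inv _ := rfl
  right_inv _ := rfl
  continuous_toFun := continuous_subtype_val.subtype_mk _
  continuous_invFun := continuous_subtype_val.subtype_mk _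

/-- The Cayley chart of the unitary group around `U`. -/
def unitaryChart (U : Matrix.unitaryGroup ι ℂ) :
    OpenPartialHomeomorph (Matrix.unitaryGroup ι ℂ) (EuclideanSpace ℝ (Fin (stiefelDim ι ι))) :=
  (unitaryHomeomorph ι).toOpenPartialHomeomorph.trans (stiefelChart (unitaryHomeomorph ι U))

/-- The smooth structure of the unitary group, induced from the space of matrices. -/
instance unitaryChartedSpace :
    ChartedSpace (EuclideanSpace ℝ (Fin (stiefelDim ι ι))) (Matrix.unitaryGroup ι ℂ) where
  atlas := Set.range unitaryChart
  chartAt := unitaryChart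
  mem_chart_source U := by
    simpa [unitaryChart] using mem_stiefelChart_source (unitaryHomeomorph ι U)
  chart_mem_atlas := Set.mem_range_self

instance unitaryIsManifold : IsManifold (𝓡 (stiefelDim ι ι)) ∞ (Matrix.unitaryGroup ι ℂ) := by
  apply isManifold_of_contDiffOn
  rintro _ _ ⟨U, rfl⟩ ⟨U', rfl⟩
  refine (contDiffOn_stiefel_transition (unitaryHomeomorph ι U) (unitaryHomeomorph ι U')).mono ?_
  rintro x ⟨hx, -⟩
  exact hx.2.2

end StiefelCharts

/-! ## Quantum channels -/

/-- The map `id_k ⊗ Φ : M_k ⊗ M_n → M_k ⊗ M_m`, with `M_k ⊗ M_n` identified with the matrices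
indexed by `Fin k × Fin n`: `Φ` is applied to each of the `k × k` blocks. -/
def ampliation {n m : ℕ} (k : ℕ)
    (Φ : Matrix (Fin n) (Fin n) ℂ →ₗ[ℂ] Matrix (Fin m) (Fin m) ℂ)
    (A : Matrix (Fin k × Fin n) (Fin k × Fin n) ℂ) :
    Matrix (Fin k × Fin m) (Fin k × Fin m) ℂ :=
  Matrix.of fun p q => Φ (Matrix.of fun c d => A (p.1, c) (q.1, d)) p.2 q.2

/-- `Φ` is completely positive: `id_k ⊗ Φ` preserves positive semidefiniteness for all `k`. -/
def IsCompletelyPositive {n m : ℕ}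
    (Φ : Matrix (Fin n) (Fin n) ℂ →ₗ[ℂ] Matrix (Fin m) (Fin m) ℂ) : Prop :=
  ∀ (k : ℕ) (A : Matrix (Fin k × Fin n) (Fin k × Fin n) ℂ),
    A.PosSemidef → (ampliation k Φ A).PosSemidef

/-- A quantum channel: a completely positive trace-preserving linear map `M_n → M_m`. -/
@[ext]
structure QuantumChannel (n m : ℕ) where
  toLinearMap : Matrix (Fin n) (Fin n) ℂ →ₗ[ℂ] Matrix (Fin m) (Fin m) ℂ
  completelyPositive : IsCompletelyPositive toLinearMap
  tracePreserving : ∀ A, (toLinearMap A).trace = A.trace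

/-- The map `A ↦ ∑_l K_l A K_l†` with Kraus operators `K_l : ℂ^n → ℂ^m`. -/
def krausSum {n m r : ℕ} (K : Fin r → Matrix (Fin m) (Fin n) ℂ) :
    Matrix (Fin n) (Fin n) ℂ →ₗ[ℂ] Matrix (Fin m) (Fin m) ℂ where
  toFun A := ∑ l, K l * A * (K l)ᴴ
  map_add' A B := by simp [Matrix.mul_add, Matrix.add_mul, Finset.sum_add_distrib]
  map_smul' c A := by simp [Finset.smul_sum]

/-- The Kraus rank: the minimum number of Kraus operators in a Kraus representation. -/
noncomputable def krausRank {n m : ℕ} (Φ : QuantumChannel n m) : ℕ :=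
  sInf {r | ∃ K : Fin r → Matrix (Fin m) (Fin n) ℂ, krausSum K = Φ.toLinearMap}

theorem isCompletelyPositive_krausSum {n m r : ℕ} (K : Fin r → Matrix (Fin m) (Fin n) ℂ) :
    IsCompletelyPositive (krausSum K) := by
  intro k A hA
  have h : ampliation k (krausSum K) A = ∑ l,
      (Matrix.of fun (p : Fin k × Fin m) (q : Fin k × Fin n) =>
        if p.1 = q.1 then K l p.2 q.2 else 0) * A *
      (Matrix.of fun (p : Fin k × Fin m) (q : Fin k × Fin n) =>
        if p.1 = q.1 then K l p.2 q.2 else 0)ᴴ := by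
    ext p q
    simp [ampliation, krausSum, Matrix.sum_apply, Matrix.mul_apply, Fintype.sum_prod_type,
      ite_mul, apply_ite]
  rw [h]
  exact Matrix.posSemidef_sum _ fun l _ => hA.mul_mul_conjTranspose_same _

theorem trace_krausSum {n m r : ℕ} (K : Fin r → Matrix (Fin m) (Fin n) ℂ)
    (hK : ∑ l, (K l)ᴴ * K l = 1) (A : Matrix (Fin n) (Fin n) ℂ) :
    (krausSum K A).trace = A.trace := by
  have h : ∀ l, (K l * A * (K l)ᴴ).trace = ((K l)ᴴ * K l * A).trace := fun l => by
    rw [Matrix.trace_mul_comm, ← Matrix.mul_assoc]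
  change (∑ l, K l * A * (K l)ᴴ).trace = _
  rw [Matrix.trace_sum, Finset.sum_congr rfl fun l _ => h l, ← Matrix.trace_sum,
    ← Finset.sum_mul, hK, Matrix.one_mul]

/-- The blocks `K_1, …, K_{nm}` (of size `m × n`) of a point `K` of `V_n(ℂ^{nm²})`; the rows of `K`
are indexed by the `nm²` pairs (number of the block, row within the block). -/
def krausBlock {n m : ℕ} (K : Matrix (Fin (n * m) × Fin m) (Fin n) ℂ) (l : Fin (n * m)) :
    Matrix (Fin m) (Fin n) ℂ :=
  Matrix.of fun a b => K (l, a) b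

theorem sum_krausBlock {n m : ℕ} (K : Matrix (Fin (n * m) × Fin m) (Fin n) ℂ) :
    ∑ l, (krausBlock K l)ᴴ * krausBlock K l = Kᴴ * K := by
  ext b c
  simp [Matrix.sum_apply, Matrix.mul_apply, krausBlock, Fintype.sum_prod_type]

/-- The map `π : V_n(ℂ^{nm²}) → Chan(n, m)`, `(K_1, …, K_{nm}) ↦ (A ↦ ∑_l K_l A K_l†)`. -/
def stiefelToChannel {n m : ℕ} (K : stiefel (Fin (n * m) × Fin m) (Fin n)) :
    QuantumChannel n m where
  toLinearMap := krausSum (krausBlock K.1)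
  completelyPositive := isCompletelyPositive_krausSum _
  tracePreserving := trace_krausSum _ ((sum_krausBlock K.1).trans K.2)

/-- The action of `U(nm)` on `V_n(ℂ^{nm²})`: the blocks of `U • K` are `∑_j u_{ij} K_j`. -/
def unitaryAct {n m : ℕ} (U : Matrix.unitaryGroup (Fin (n * m)) ℂ)
    (K : stiefel (Fin (n * m) × Fin m) (Fin n)) : stiefel (Fin (n * m) × Fin m) (Fin n) :=
  ⟨Matrix.of fun p b => (∑ j, U.1 p.1 j • krausBlock K.1 j) p.2 b, by
    have hU : (U.1)ᴴ * U.1 = 1 := Matrix.mem_unitaryGroup_iff'.mp U.2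
    have hK : (K.1)ᴴ * K.1 = 1 := K.2
    have h : (Matrix.of fun p b => (∑ j, U.1 p.1 j • krausBlock K.1 j) p.2 b) =
        Matrix.kroneckerMap (· * ·) U.1 (1 : Matrix (Fin m) (Fin m) ℂ) * K.1 := by
      ext p b
      simp [Matrix.sum_apply, Matrix.mul_apply, Fintype.sum_prod_type, krausBlock,
        Matrix.one_apply]
    change _ᴴ * _ = (1 : Matrix _ _ ℂ)
    rw [h, Matrix.conjTranspose_mul, Matrix.mul_assoc, ← Matrix.mul_assoc _ _ K.1,
      Matrix.conjTranspose_kronecker, ← Matrix.mul_kronecker_mul, hU]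
    simp [hK]⟩

/-- The fibre `π⁻¹(Φ)`, with the subspace topology of `V_n(ℂ^{nm²})`. -/
def channelFibre {n m : ℕ} (Φ : QuantumChannel n m) :
    Set (stiefel (Fin (n * m) × Fin m) (Fin n)) :=
  stiefelToChannel ⁻¹' {Φ}

/-! Write a Kraus family as a matrix `X` whose rows are the flattened operators. The entries of the
Gram matrix `X† X` are exactly the entries of the channel on matrix units, so two families, possibly
of different lengths, define the same channel if and only if their Gram matrices agree
(`krausSum_eq_iff`). The study of the fibre thereby becomes the study of the equation `X† X = L† L`,
where `L` comes from a family of minimal length `k`.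

Minimality makes the rows of `L` linearly independent: otherwise compressing to the orthogonal
complement of a relation would give a shorter family with the same Gram matrix
(`exists_gram_eq_of_det_eq_zero`). Hence `L` has a right inverse `R`, and the solutions of `X† X =
L† L` are exactly `X = A L` with `A† A = 1`, where `A = X R` is unique (`gram_eq_factor`). Trace
preservation puts every such `X` on the ambient Stiefel manifold, so `A ↦ A L` is a homeomorphism
from `V_k(ℂ^{nm})` onto the fibre. Left multiplication by `U(nm)` on `X` corresponds to left
multiplication on `A`, where it is transitive; this is the orbit statement.

The fibre receives its smooth structure through this homeomorphism. The inclusion is linear in `A`,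
and `X ↦ X R` is a linear left inverse defined on all matrices. The inclusion therefore has
injective differential, and the inverse function theorem makes it an immersion; it is a topological
embedding because the fibre carries the subspace topology.

For the last claim, a diffeomorphism with `U(nm)` preserves dimension, and the dimensions of `U(nm)`
and `V_k(ℂ^{nm})` differ by `(nm - k)²`. -/

/-! ### Channels and Gram matrices -/

/-- The matrix whose rows are the entries of the operators `K l`. -/
def krausMatrix {n m r : ℕ} (K : Fin r → Matrix (Fin m) (Fin n) ℂ) :
    Matrix (Fin r) (Fin m × Fin n) ℂ :=
  Matrix.of fun l p => K l p.1 p.2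

theorem krausSum_apply_eq_gram {n m r : ℕ} (K : Fin r → Matrix (Fin m) (Fin n) ℂ)
    (A : Matrix (Fin n) (Fin n) ℂ) (a a' : Fin m) :
    krausSum K A a a' =
      ∑ b', ∑ b, A b b' * ((krausMatrix K)ᴴ * krausMatrix K) (a', b') (a, b) := by
  simp only [krausSum, LinearMap.coe_mk, AddHom.coe_mk, Matrix.sum_apply, Matrix.mul_apply,
    krausMatrix, Matrix.conjTranspose_apply, Matrix.of_apply, Finset.mul_sum, Finset.sum_mul]
  rw [Finset.sum_comm]
  refine Finset.sum_congr rfl fun b' _ => ?_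
  rw [Finset.sum_comm]
  exact Finset.sum_congr rfl fun b _ => Finset.sum_congr rfl fun l _ => by ring

theorem krausSum_single_apply {n m r : ℕ} (K : Fin r → Matrix (Fin m) (Fin n) ℂ)
    (b b' : Fin n) (a a' : Fin m) :
    krausSum K (Matrix.single b b' 1) a a' =
      ((krausMatrix K)ᴴ * krausMatrix K) (a', b') (a, b) := by
  rw [krausSum_apply_eq_gram, Finset.sum_eq_single b', Finset.sum_eq_single b]
  · simp
  · intro c _ hc
    simp [hc.symm]
  · simp
  · intro c _ hc
    simp [hc.symm]
  · simp

/-- Values on matrix units are single entries of the Gram matrix, and by linearity these entries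
determine every value. The lengths `r` and `s` are independent, so that a family of `nm` blocks can
be compared with a minimal one. -/
theorem krausSum_eq_iff {n m r s : ℕ} (K : Fin r → Matrix (Fin m) (Fin n) ℂ)
    (K' : Fin s → Matrix (Fin m) (Fin n) ℂ) :
    krausSum K = krausSum K' ↔
      (krausMatrix K)ᴴ * krausMatrix K = (krausMatrix K')ᴴ * krausMatrix K' := by
  constructor
  · intro h
    ext ⟨a', b'⟩ ⟨a, b⟩
    rw [← krausSum_single_apply, ← krausSum_single_apply, h]
  · intro h
    ext A a a'
    rw [krausSum_apply_eq_gram, krausSum_apply_eq_gram, h]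

theorem linearMap_matrix_ext_single {n m : ℕ}
    {Φ Ψ : Matrix (Fin n) (Fin n) ℂ →ₗ[ℂ] Matrix (Fin m) (Fin m) ℂ}
    (h : ∀ b b', Φ (Matrix.single b b' 1) = Ψ (Matrix.single b b' 1)) : Φ = Ψ := by
  apply Matrix.ext_linearMap
  intro b b'
  apply LinearMap.ext_ring
  simpa using h b b'

/-! ### Choi's theorem and minimal Kraus families -/

open scoped MatrixOrder in
/-- Choi's theorem: a completely positive map `M_n → M_m` has `nm` Kraus operators. -/
theorem IsCompletelyPositive.exists_krausSum_eq {n m : ℕ}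
    {Φ : Matrix (Fin n) (Fin n) ℂ →ₗ[ℂ] Matrix (Fin m) (Fin m) ℂ} (h : IsCompletelyPositive Φ) :
    ∃ K : Fin (n * m) → Matrix (Fin m) (Fin n) ℂ, krausSum K = Φ := by
  -- The unnormalised maximally entangled vector: applying `id ⊗ Φ` to `v v†` gives the Choi matrix,
  -- whose blocks are the values of `Φ` on matrix units.
  let v : Fin n × Fin n → ℂ := fun p => if p.1 = p.2 then 1 else 0
  have hv := h n _ (Matrix.posSemidef_vecMulVec_self_star v)
  have hc : ∀ p q, ampliation n Φ (Matrix.vecMulVec v (star v)) p q =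
      Φ (Matrix.single p.1 q.1 1) p.2 q.2 := by
    intro p q
    simp only [ampliation, Matrix.of_apply]
    refine congrFun (congrFun (?_ : Φ _ = Φ _) _) _
    refine congrArg Φ ?_
    ext c d
    by_cases h₁ : p.1 = c <;> by_cases h₂ : q.1 = d <;>
      simp [Matrix.vecMulVec_apply, v, h₁, h₂]
  obtain ⟨M, hM⟩ := CStarAlgebra.nonneg_iff_eq_star_mul_self.mp hv.nonneg
  -- The conjugate is needed because the Gram matrix of a Kraus family is, up to swapping the two
  -- indices in each pair, the transpose of the Choi matrix `M† M`.
  refine ⟨fun l => Matrix.of fun a b => star (M (finProdFinEquiv.symm l) (b, a)), ?_⟩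
  apply linearMap_matrix_ext_single
  intro b b'
  ext a a'
  rw [krausSum_single_apply, ← hc (b, a) (b', a'), hM]
  simp only [Matrix.mul_apply, Matrix.conjTranspose_apply, krausMatrix, Matrix.of_apply, star_star]
  rw [← finProdFinEquiv.symm.sum_comp]
  exact Finset.sum_congr rfl fun _ _ => mul_comm _ _

theorem krausRank_le {n m : ℕ} (Φ : QuantumChannel n m) : krausRank Φ ≤ n * m :=
  Nat.sInf_le Φ.completelyPositive.exists_krausSum_eq

theorem exists_krausSum_eq_of_krausRank {n m : ℕ} (Φ : QuantumChannel n m) :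
    ∃ K : Fin (krausRank Φ) → Matrix (Fin m) (Fin n) ℂ, krausSum K = Φ.toLinearMap :=
  Nat.sInf_mem (s := {r | ∃ K : Fin r → Matrix (Fin m) (Fin n) ℂ, krausSum K = Φ.toLinearMap})
    ⟨_, Φ.completelyPositive.exists_krausSum_eq⟩

/-- If the rows of `L` are linearly dependent, then `L† L` is the Gram matrix of a matrix with
fewer rows. -/
theorem exists_gram_eq_of_det_eq_zero {k : ℕ} {β : Type*} [Fintype β] (L : Matrix (Fin k) β ℂ)
    (h : (L * Lᴴ).det = 0) :
    ∃ r < k, ∃ L' : Matrix (Fin r) β ℂ, L'ᴴ * L' = Lᴴ * L := by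
  obtain ⟨v, hv, hv0⟩ := Matrix.exists_mulVec_eq_zero_iff.mpr h
  have hk : k ≠ 0 := by
    rintro rfl
    exact hv (Subsingleton.elim _ _)
  have hLv : Lᴴ *ᵥ v = 0 := by
    have h1 : star (Lᴴ *ᵥ v) ⬝ᵥ (Lᴴ *ᵥ v) = 0 := by
      rw [Matrix.star_mulVec, Matrix.conjTranspose_conjTranspose, ← Matrix.dotProduct_mulVec,
        Matrix.mulVec_mulVec, hv0]
      simp
    exact dotProduct_star_self_eq_zero.mp h1
  have hpos : star v ⬝ᵥ v ≠ 0 := fun h0 =>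
    hv (dotProduct_star_self_eq_zero.mp h0)
  obtain ⟨c, hc⟩ : ∃ c : ℝ, star v ⬝ᵥ v = c ∧ 0 ≤ c := by
    have := dotProduct_star_self_nonneg v
    exact ⟨(star v ⬝ᵥ v).re, (Complex.eq_re_of_ofReal_le this : _), (Complex.le_def.mp this).1⟩
  let A : Matrix (Fin k) (Fin 1) ℂ := Matrix.of fun i _ => ((√c)⁻¹ : ℝ) * v i
  have hA : Aᴴ * A = 1 := by
    ext i j
    have : (Aᴴ * A) i j = ((√c)⁻¹ : ℝ) * ((√c)⁻¹ : ℝ) * (star v ⬝ᵥ v) := by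
      simp only [A, Matrix.mul_apply, Matrix.conjTranspose_apply, Matrix.of_apply, dotProduct,
        Finset.mul_sum]
      refine Finset.sum_congr rfl fun x _ => ?_
      simp
      ring
    rw [this, Subsingleton.elim i j, Matrix.one_apply_eq, hc.1]
    have hc0 : c ≠ 0 := by
      rintro rfl
      exact hpos (by simpa using hc.1)
    norm_cast
    rw [← mul_inv, Real.mul_self_sqrt hc.2, inv_mul_cancel₀ hc0]
  have hLA : Lᴴ * A = 0 := by
    ext i j
    have := congrFun hLv i
    simp only [Matrix.mulVec, dotProduct, Pi.zero_apply] at this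
    simp only [A, Matrix.mul_apply, Matrix.of_apply, Matrix.zero_apply]
    rw [← mul_zero (((√c)⁻¹ : ℝ) : ℂ), ← this, Finset.mul_sum]
    exact Finset.sum_congr rfl fun _ _ => by ring
  -- The `k - 1` columns of `B` span the orthogonal complement of `v`, which contains the columns of
  -- `L`; so `B B†` fixes `L`, and `B† L` keeps the Gram matrix while losing a row.
  obtain ⟨B, hB⟩ := exists_stiefelCompletion (⟨A, hA⟩ : stiefel (Fin k) (Fin 1))
  have hfull : B * Bᴴ = 1 - A * Aᴴ := eq_sub_of_add_eq' hB.full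
  refine ⟨_, by simp only [Fintype.card_fin]; omega, Bᴴ * L, ?_⟩
  calc (Bᴴ * L)ᴴ * (Bᴴ * L) = Lᴴ * (B * Bᴴ) * L := by
        simp only [Matrix.conjTranspose_mul, Matrix.conjTranspose_conjTranspose, Matrix.mul_assoc]
    _ = Lᴴ * L - (Lᴴ * A) * Aᴴ * L := by
        rw [hfull]
        simp only [Matrix.mul_sub, Matrix.sub_mul, Matrix.mul_one, Matrix.mul_assoc]
    _ = Lᴴ * L := by rw [hLA]; simp

/-- A singular `L L†` would yield a shorter family with the same Gram matrix, hence the same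
channel, against minimality of the Kraus rank. -/
theorem isUnit_det_gram_krausMatrix {n m : ℕ} (Φ : QuantumChannel n m)
    (K : Fin (krausRank Φ) → Matrix (Fin m) (Fin n) ℂ) (hK : krausSum K = Φ.toLinearMap) :
    IsUnit (krausMatrix K * (krausMatrix K)ᴴ).det := by
  rw [isUnit_iff_ne_zero]
  intro h
  obtain ⟨r, hr, L, hL⟩ := exists_gram_eq_of_det_eq_zero _ h
  let K' : Fin r → Matrix (Fin m) (Fin n) ℂ := fun l => Matrix.of fun a b => L l (a, b)
  have hK' : krausMatrix K' = L := rfl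
  have h' : krausSum K' = Φ.toLinearMap := by
    rw [← hK, krausSum_eq_iff, hK', hL]
  exact hr.not_ge (Nat.sInf_le ⟨K', h'⟩)

/-! ### Factoring through a minimal family; transitivity of the unitary group -/

/-- If `X† X = L† L` and `R` is a right inverse of `L`, then `X = (X R) L`, where `X R` has
orthonormal columns. -/
theorem gram_eq_factor {α κ β : Type*} [Fintype α] [Fintype κ] [DecidableEq κ] [Fintype β]
    [DecidableEq β] {X : Matrix α β ℂ} {L : Matrix κ β ℂ} {R : Matrix β κ ℂ}
    (hR : L * R = 1) (h : Xᴴ * X = Lᴴ * L) :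
    (X * R)ᴴ * (X * R) = 1 ∧ X * R * L = X := by
  constructor
  · calc (X * R)ᴴ * (X * R) = Rᴴ * (Xᴴ * X) * R := by
          simp only [Matrix.conjTranspose_mul, Matrix.mul_assoc]
      _ = (L * R)ᴴ * (L * R) := by
          rw [h]; simp only [Matrix.conjTranspose_mul, Matrix.mul_assoc]
      _ = 1 := by rw [hR]; simp
  -- The difference is `X (1 - R L)`. Its Gram matrix depends only on `X† X = L† L`, and `L (1 - R
  -- L) = 0`.
  · have h0 : (X - X * R * L)ᴴ * (X - X * R * L) = 0 := by
      have e : X - X * R * L = X * (1 - R * L) := by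
        rw [Matrix.mul_sub, Matrix.mul_one, Matrix.mul_assoc]
      have e' : L * (1 - R * L) = 0 := by
        rw [Matrix.mul_sub, Matrix.mul_one, ← Matrix.mul_assoc, hR, Matrix.one_mul, sub_self]
      calc _ = (1 - R * L)ᴴ * (Xᴴ * X) * (1 - R * L) := by
            rw [e]; simp only [Matrix.conjTranspose_mul, Matrix.mul_assoc]
        _ = (1 - R * L)ᴴ * Lᴴ * (L * (1 - R * L)) := by
            rw [h]; simp only [Matrix.mul_assoc]
        _ = 0 := by rw [e', Matrix.mul_zero]
    exact (sub_eq_zero.mp (Matrix.conjTranspose_mul_self_eq_zero.mp h0)).symm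

/-- The unitary group acts transitively on the Stiefel manifold. -/
theorem exists_unitary_mul_eq {ι κ : Type} [Fintype ι] [DecidableEq ι] [Fintype κ] [DecidableEq κ]
    (A A' : stiefel ι κ) : ∃ U : Matrix.unitaryGroup ι ℂ, U.1 * A.1 = A'.1 := by
  have h := stiefelCompletion_spec A
  have h' := stiefelCompletion_spec A'
  set B := stiefelCompletion A
  set B' := stiefelCompletion A'
  have hBA : Bᴴ * A.1 = 0 := by
    simpa [Matrix.conjTranspose_mul] using congrArg Matrix.conjTranspose h.orth
  -- This is `[A' B'] [A B]†`, the change between the two orthonormal bases.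
  refine ⟨⟨A'.1 * A.1ᴴ + B' * Bᴴ, Matrix.mem_unitaryGroup_iff.mpr ?_⟩, ?_⟩
  · rw [Matrix.star_eq_conjTranspose, Matrix.conjTranspose_add, Matrix.conjTranspose_mul,
      Matrix.conjTranspose_mul, Matrix.conjTranspose_conjTranspose,
      Matrix.conjTranspose_conjTranspose]
    calc _ = A'.1 * (A.1ᴴ * A.1) * A'.1ᴴ + A'.1 * (A.1ᴴ * B) * B'ᴴ
          + B' * (Bᴴ * A.1) * A'.1ᴴ + B' * (Bᴴ * B) * B'ᴴ := by
            simp only [Matrix.mul_add, Matrix.add_mul, Matrix.mul_assoc]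
            abel
      _ = _ := by rw [h.left, h.right, h.orth, hBA]; simp [h'.full]
  · change (A'.1 * A.1ᴴ + B' * Bᴴ) * A.1 = A'.1
    rw [Matrix.add_mul, Matrix.mul_assoc, Matrix.mul_assoc, h.left, hBA]
    simp

/-! ### The fibre as the solutions of a Gram equation -/

/-- The rows of `K` regrouped by blocks. -/
def blockMatrix {n m : ℕ} (K : Matrix (Fin (n * m) × Fin m) (Fin n) ℂ) :
    Matrix (Fin (n * m)) (Fin m × Fin n) ℂ :=
  Matrix.of fun l p => K (l, p.1) p.2

/-- The inverse of `blockMatrix`. -/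
def unblockMatrix {n m : ℕ} (X : Matrix (Fin (n * m)) (Fin m × Fin n) ℂ) :
    Matrix (Fin (n * m) × Fin m) (Fin n) ℂ :=
  Matrix.of fun p b => X p.1 (p.2, b)

theorem krausMatrix_krausBlock {n m : ℕ} (K : Matrix (Fin (n * m) × Fin m) (Fin n) ℂ) :
    krausMatrix (krausBlock K) = blockMatrix K := rfl

theorem blockMatrix_unblockMatrix {n m : ℕ} (X : Matrix (Fin (n * m)) (Fin m × Fin n) ℂ) :
    blockMatrix (unblockMatrix X) = X := rfl

theorem unblockMatrix_blockMatrix {n m : ℕ} (K : Matrix (Fin (n * m) × Fin m) (Fin n) ℂ) :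
    unblockMatrix (blockMatrix K) = K := rfl

theorem blockMatrix_unitaryAct {n m : ℕ} (U : Matrix.unitaryGroup (Fin (n * m)) ℂ)
    (K : stiefel (Fin (n * m) × Fin m) (Fin n)) :
    blockMatrix (unitaryAct U K).1 = U.1 * blockMatrix K.1 := by
  ext l p
  simp [blockMatrix, unitaryAct, Matrix.mul_apply, Matrix.sum_apply, krausBlock]

/-- By cyclicity, the trace of `(∑ K_l† K_l) A` is that of `Φ(A)`, hence that of `A`, for every `A`;
the trace pairing is nondegenerate. Thus the Stiefel condition imposes nothing beyond the Gram
equation. -/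
theorem mem_stiefel_of_krausSum_eq {n m : ℕ} (Φ : QuantumChannel n m)
    (K : Matrix (Fin (n * m) × Fin m) (Fin n) ℂ) (h : krausSum (krausBlock K) = Φ.toLinearMap) :
    K ∈ stiefel (Fin (n * m) × Fin m) (Fin n) := by
  change Kᴴ * K = 1
  rw [← sum_krausBlock]
  apply Matrix.ext_iff_trace_mul_right.mpr
  intro A
  rw [Matrix.one_mul, ← Φ.tracePreserving A, ← h, krausSum, LinearMap.coe_mk, AddHom.coe_mk,
    Matrix.trace_sum, Finset.sum_mul, Matrix.trace_sum]
  refine Finset.sum_congr rfl fun l _ => ?_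
  rw [Matrix.trace_mul_comm (krausBlock K l * A), ← Matrix.mul_assoc]

theorem mem_channelFibre_iff {n m k : ℕ} {Φ : QuantumChannel n m}
    {K₀ : Fin k → Matrix (Fin m) (Fin n) ℂ} (hK₀ : krausSum K₀ = Φ.toLinearMap)
    (K : stiefel (Fin (n * m) × Fin m) (Fin n)) :
    K ∈ channelFibre Φ ↔
      (blockMatrix K.1)ᴴ * blockMatrix K.1 = (krausMatrix K₀)ᴴ * krausMatrix K₀ := by
  rw [← krausMatrix_krausBlock, ← krausSum_eq_iff, hK₀]
  exact QuantumChannel.ext_iff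

/-- A right inverse of the matrix of a minimal family of Kraus operators. -/
noncomputable def krausRightInv {n m k : ℕ} (K₀ : Fin k → Matrix (Fin m) (Fin n) ℂ) :
    Matrix (Fin m × Fin n) (Fin k) ℂ :=
  (krausMatrix K₀)ᴴ * (krausMatrix K₀ * (krausMatrix K₀)ᴴ)⁻¹

theorem krausMatrix_mul_rightInv {n m k : ℕ} {K₀ : Fin k → Matrix (Fin m) (Fin n) ℂ}
    (h : IsUnit (krausMatrix K₀ * (krausMatrix K₀)ᴴ).det) :
    krausMatrix K₀ * krausRightInv K₀ = 1 := by
  rw [krausRightInv, ← Matrix.mul_assoc, Matrix.mul_nonsing_inv _ h]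

theorem gram_mul_of_isometry {α κ β : Type*} [Fintype α] [Fintype κ] [DecidableEq κ] [Fintype β]
    {A : Matrix α κ ℂ} (hA : Aᴴ * A = 1) (L : Matrix κ β ℂ) : (A * L)ᴴ * (A * L) = Lᴴ * L := by
  rw [Matrix.conjTranspose_mul, Matrix.mul_assoc, ← Matrix.mul_assoc Aᴴ, hA, Matrix.one_mul]

/-- The fibre over `Φ` is parametrized by a Stiefel manifold, through `A ↦ (∑_j A_{ij} L_j)_i`
where `L` is a minimal family of Kraus operators. -/
noncomputable def channelFibreHomeomorph {n m k : ℕ} {Φ : QuantumChannel n m}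
    {K₀ : Fin k → Matrix (Fin m) (Fin n) ℂ} (hK₀ : krausSum K₀ = Φ.toLinearMap)
    (h : IsUnit (krausMatrix K₀ * (krausMatrix K₀)ᴴ).det) :
    channelFibre Φ ≃ₜ stiefel (Fin (n * m)) (Fin k) where
  toFun K := ⟨blockMatrix K.1.1 * krausRightInv K₀,
    (gram_eq_factor (krausMatrix_mul_rightInv h) ((mem_channelFibre_iff hK₀ K.1).mp K.2)).1⟩
  invFun A :=
    have hA : krausSum (krausBlock (unblockMatrix (A.1 * krausMatrix K₀))) = Φ.toLinearMap := by
      rw [← hK₀, krausSum_eq_iff, krausMatrix_krausBlock, blockMatrix_unblockMatrix]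
      exact gram_mul_of_isometry A.2 _
    ⟨⟨unblockMatrix (A.1 * krausMatrix K₀), mem_stiefel_of_krausSum_eq Φ _ hA⟩,
      QuantumChannel.ext hA⟩
  left_inv K := by
    apply Subtype.ext
    apply Subtype.ext
    change unblockMatrix (blockMatrix K.1.1 * krausRightInv K₀ * krausMatrix K₀) = K.1.1
    rw [(gram_eq_factor (krausMatrix_mul_rightInv h) ((mem_channelFibre_iff hK₀ K.1).mp K.2)).2,
      unblockMatrix_blockMatrix]
  right_inv A := by
    apply Subtype.ext
    change blockMatrix (unblockMatrix (A.1 * krausMatrix K₀)) * krausRightInv K₀ = A.1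
    rw [blockMatrix_unblockMatrix, Matrix.mul_assoc, krausMatrix_mul_rightInv h, Matrix.mul_one]
  continuous_toFun := by
    refine Continuous.subtype_mk (Continuous.matrix_mul ?_ continuous_const) _
    exact continuous_matrix fun i j =>
      (continuous_subtype_val.comp continuous_subtype_val).matrix_elem _ _
  continuous_invFun := by
    refine Continuous.subtype_mk (Continuous.subtype_mk ?_ _) _
    exact continuous_matrix fun i j =>
      (continuous_subtype_val.matrix_mul continuous_const).matrix_elem _ _

/-- Two points of the fibre are `A L` and `A' L` with the same `L`, so a unitary taking `A` to `A'`
takes one to the other. Conversely, a unitary does not change the Gram matrix. -/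
theorem channelFibre_eq_range_unitaryAct {n m : ℕ} {Φ : QuantumChannel n m}
    {K : stiefel (Fin (n * m) × Fin m) (Fin n)} (hK : K ∈ channelFibre Φ) :
    channelFibre Φ =
      Set.range fun U : Matrix.unitaryGroup (Fin (n * m)) ℂ => unitaryAct U K := by
  obtain ⟨K₀, hK₀⟩ := exists_krausSum_eq_of_krausRank Φ
  have h := isUnit_det_gram_krausMatrix Φ K₀ hK₀
  ext K'
  constructor
  · intro hK'
    obtain ⟨U, hU⟩ := exists_unitary_mul_eq (channelFibreHomeomorph hK₀ h ⟨K, hK⟩)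
      (channelFibreHomeomorph hK₀ h ⟨K', hK'⟩)
    have e := (gram_eq_factor (krausMatrix_mul_rightInv h) ((mem_channelFibre_iff hK₀ K).mp hK)).2
    have e' := (gram_eq_factor (krausMatrix_mul_rightInv h)
      ((mem_channelFibre_iff hK₀ K').mp hK')).2
    refine ⟨U, Subtype.ext ?_⟩
    rw [← unblockMatrix_blockMatrix K'.1, ← e', ← unblockMatrix_blockMatrix (unitaryAct U K).1,
      blockMatrix_unitaryAct]
    congr 1
    rw [← e, ← Matrix.mul_assoc]
    exact congrArg (· * krausMatrix K₀) hU
  · rintro ⟨U, rfl⟩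
    rw [mem_channelFibre_iff hK₀] at hK ⊢
    rw [blockMatrix_unitaryAct, ← hK]
    exact gram_mul_of_isometry (Matrix.mem_unitaryGroup_iff'.mp U.2) _

/-! ### Transport of a smooth structure along a homeomorphism -/

section Pullback

variable {𝕜 : Type*} [NontriviallyNormedField 𝕜] {E : Type*} [NormedAddCommGroup E]
  [NormedSpace 𝕜 E] {H : Type*} [TopologicalSpace H] {I : ModelWithCorners 𝕜 E H} {r : ℕ∞ω}
  {M N : Type*} [TopologicalSpace M] [TopologicalSpace N] [ChartedSpace H N]

/-- The charts of `N`, transported to `M` by a homeomorphism. -/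
@[reducible]
def Homeomorph.pullbackChartedSpace (h : M ≃ₜ N) : ChartedSpace H M where
  atlas := (fun e => h.toOpenPartialHomeomorph.trans e) '' atlas H N
  chartAt x := h.toOpenPartialHomeomorph.trans (chartAt H (h x))
  mem_chart_source x := by simp
  chart_mem_atlas x := Set.mem_image_of_mem _ (chart_mem_atlas H (h x))

/-- In a transition map between transported charts the homeomorphism cancels, leaving a transition
map of `N`. -/
theorem Homeomorph.isManifold_pullback (h : M ≃ₜ N) [IsManifold I r N] :
    letI := h.pullbackChartedSpace (H := H)
    IsManifold I r M := by
  let _ := h.pullbackChartedSpace (H := H)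
  refine IsManifold.mk' I r M (gr := ⟨?_⟩)
  rintro _ _ ⟨e, he, rfl⟩ ⟨e', he', rfl⟩
  refine StructureGroupoid.mem_of_eqOnSource _
    (StructureGroupoid.compatible (contDiffGroupoid r I) he he') ⟨?_, ?_⟩
  · ext y
    simp
  · intro y _
    simp

/-- Read in the matching preferred charts, both `h` and its inverse are the identity. -/
theorem Homeomorph.contMDiff_of_chartAt_eq [ChartedSpace H M] [IsManifold I r M]
    [IsManifold I r N] (h : M ≃ₜ N)
    (hc : ∀ x, chartAt H x = h.toOpenPartialHomeomorph.trans (chartAt H (h x))) :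
    ContMDiff I I r h ∧ ContMDiff I I r h.symm := by
  have hs : ∀ x, (chartAt H x).source = h ⁻¹' (chartAt H (h x)).source := fun x => by
    rw [hc]; simp
  constructor
  · intro x
    have h1 : ContMDiffOn I I r ((chartAt H (h x)).symm ∘ chartAt H x) (chartAt H x).source :=
      contMDiffOn_chart_symm.comp contMDiffOn_chart fun y hy => by
        rw [hs] at hy
        simpa [hc x] using (chartAt H (h x)).map_source hy
    refine (h1.congr fun y hy => ?_).contMDiffAt
      ((chartAt H x).open_source.mem_nhds (mem_chart_source H x))
    rw [hs] at hy
    simp [hc x, (chartAt H (h x)).left_inv hy]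
  · intro y
    obtain ⟨x, rfl⟩ := h.surjective y
    have h1 : ContMDiffOn I I r ((chartAt H x).symm ∘ chartAt H (h x))
        (chartAt H (h x)).source :=
      contMDiffOn_chart_symm.comp contMDiffOn_chart fun z hz => by
        simpa [hc x] using (chartAt H (h x)).map_source hz
    refine (h1.congr fun z hz => ?_).contMDiffAt
      ((chartAt H (h x)).open_source.mem_nhds (mem_chart_source H (h x)))
    simp [hc x, (chartAt H (h x)).left_inv hz]

/-- A homeomorphism which matches the preferred charts is a diffeomorphism. -/
def Homeomorph.toDiffeomorphOfChartAtEq [ChartedSpace H M] [IsManifold I r M]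
    [IsManifold I r N] (h : M ≃ₜ N)
    (hc : ∀ x, chartAt H x = h.toOpenPartialHomeomorph.trans (chartAt H (h x))) :
    M ≃ₘ^r⟮I, I⟯ N where
  toEquiv := h.toEquiv
  contMDiff_toFun := (h.contMDiff_of_chartAt_eq hc).1
  contMDiff_invFun := (h.contMDiff_of_chartAt_eq hc).2

end Pullback

/-! ### Injective differential implies immersion -/

section Immersion

variable {E F E' : Type*} [NormedAddCommGroup E] [NormedSpace ℝ E] [FiniteDimensional ℝ E]
  [NormedAddCommGroup F] [NormedSpace ℝ F] [FiniteDimensional ℝ F]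
  [NormedAddCommGroup E'] [NormedSpace ℝ E'] [FiniteDimensional ℝ E']

theorem exists_continuousLinearEquiv_prod_extending {T : E →L[ℝ] E'}
    (hT : Function.Injective T)
    (hdim : Module.finrank ℝ E + Module.finrank ℝ F = Module.finrank ℝ E') :
    ∃ e : (E × F) ≃L[ℝ] E', ∀ u, e (u, 0) = T u := by
  obtain ⟨W, hW⟩ := Submodule.exists_isCompl (LinearMap.range T.toLinearMap)
  let e₁ : E ≃ₗ[ℝ] LinearMap.range T.toLinearMap := LinearEquiv.ofInjective T.toLinearMap hT
  have h2 : Module.finrank ℝ F = Module.finrank ℝ W := by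
    have := Submodule.finrank_add_eq_of_isCompl hW
    rw [← e₁.finrank_eq] at this
    omega
  let e : (E × F) ≃ₗ[ℝ] E' :=
    (e₁.prodCongr (LinearEquiv.ofFinrankEq F W h2)).trans (Submodule.prodEquivOfIsCompl _ W hW)
  exact ⟨e.toContinuousLinearEquiv, fun u => by simp [e, e₁]⟩

-- Straightening by the inverse function theorem: `f` is thickened in the directions of `F` to a
-- local diffeomorphism of `E'`, whose restriction to the slice `e (u, 0)` is `f`.
omit [FiniteDimensional ℝ E] [FiniteDimensional ℝ F] in
theorem exists_openPartialHomeomorph_extending {f : E → E'} {U : Set E} (hU : IsOpen U) {a : E}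
    (ha : a ∈ U) (hf : ContDiffOn ℝ ∞ f U) (e : (E × F) ≃L[ℝ] E')
    (he : ∀ u, e (u, 0) = fderiv ℝ f a u) :
    ∃ Θ : OpenPartialHomeomorph E' E', e (a, 0) ∈ Θ.source ∧ ContDiffOn ℝ ∞ Θ Θ.source ∧
      ContDiffOn ℝ ∞ Θ.symm Θ.target ∧ ∀ u, Θ (e (u, 0)) = f u := by
  -- At `e (u, w)` this is `f u + e (0, w)`. Since `e` extends the differential of `f` at `a`, the
  -- derivative of `k` at `e (a, 0)` is the identity.
  let k : E' → E' := fun y => f (e.symm y).1 + e (0, (e.symm y).2)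
  let U' : Set E' := (fun y => (e.symm y).1) ⁻¹' U
  have hU' : IsOpen U' := hU.preimage (continuous_fst.comp e.symm.continuous)
  have hkU : ContDiffOn ℝ ∞ k U' := by
    refine ContDiffOn.add (hf.comp ?_ fun y hy => hy) ?_
    · exact (contDiff_fst.comp e.symm.contDiff).contDiffOn
    · exact (e.contDiff.comp
        (contDiff_const.prodMk (contDiff_snd.comp e.symm.contDiff))).contDiffOn
  have haU : e (a, 0) ∈ U' := by simpa [U'] using ha
  have hk : ContDiffAt ℝ ∞ k (e (a, 0)) := hkU.contDiffAt (hU'.mem_nhds haU)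
  have hk' : HasFDerivAt k ((ContinuousLinearEquiv.refl ℝ E' : E' ≃L[ℝ] E') : E' →L[ℝ] E')
      (e (a, 0)) := by
    have h1 : HasFDerivAt f (fderiv ℝ f a) (e.symm (e (a, 0))).1 := by
      simpa using ((hf.contDiffAt (hU.mem_nhds ha)).differentiableAt (by simp)).hasFDerivAt
    have h2 : HasFDerivAt (fun y => (e.symm y).1)
        ((ContinuousLinearMap.fst ℝ E F).comp (e.symm : E' →L[ℝ] E × F)) (e (a, 0)) :=
      ((ContinuousLinearMap.fst ℝ E F).comp (e.symm : E' →L[ℝ] E × F)).hasFDerivAt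
    have h3 : HasFDerivAt (fun y => e (0, (e.symm y).2))
        ((e : E × F →L[ℝ] E').comp ((ContinuousLinearMap.inr ℝ E F).comp
          ((ContinuousLinearMap.snd ℝ E F).comp (e.symm : E' →L[ℝ] E × F)))) (e (a, 0)) :=
      ((e : E × F →L[ℝ] E').comp ((ContinuousLinearMap.inr ℝ E F).comp
          ((ContinuousLinearMap.snd ℝ E F).comp (e.symm : E' →L[ℝ] E × F)))).hasFDerivAt
    refine ((h1.comp (e (a, 0)) h2).add h3).congr_fderiv ?_
    ext y
    obtain ⟨⟨u, w⟩, rfl⟩ := e.surjective y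
    simp [← he, ← map_add]
  -- Restricting to points where the derivative of `k` is invertible makes the local inverse smooth
  -- on its whole domain, not just at the image of the base point.
  let S : Set E' := U' ∩ fderiv ℝ k ⁻¹' Set.range ((↑) : (E' ≃L[ℝ] E') → E' →L[ℝ] E')
  have hS : IsOpen S :=
    (hkU.continuousOn_fderiv_of_isOpen hU' (by simp)).isOpen_inter_preimage hU'
      ContinuousLinearEquiv.isOpen
  let T := hk.toOpenPartialHomeomorph k hk' (by simp)
  refine ⟨T.restrOpen S hS, ⟨hk.mem_toOpenPartialHomeomorph_source hk' (by simp), haU, ?_⟩,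
    hkU.mono fun y hy => hy.2.1, ?_, fun u => ?_⟩
  · exact ⟨_, hk'.fderiv.symm⟩
  · intro y hy
    have hy' := (T.restrOpen S hS).map_target hy
    obtain ⟨g, hg⟩ := hy'.2.2
    have hd : ContDiffAt ℝ ∞ k ((T.restrOpen S hS).symm y) :=
      hkU.contDiffAt (hU'.mem_nhds hy'.2.1)
    refine ((T.restrOpen S hS).contDiffAt_symm (f₀' := g) hy ?_ hd).contDiffWithinAt
    rw [hg]
    exact (hd.differentiableAt (by simp)).hasFDerivAt
  · change f (e.symm (e (u, 0))).1 + e (0, (e.symm (e (u, 0))).2) = f u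
    simp

variable {M N : Type*} [TopologicalSpace M] [ChartedSpace E M] [IsManifold 𝓘(ℝ, E) ∞ M]
  [TopologicalSpace N] [ChartedSpace E' N] [IsManifold 𝓘(ℝ, E') ∞ N]

/-- A smooth map between finite-dimensional manifolds with injective differential at `x` is an
immersion at `x`. -/
theorem ContMDiff.isImmersionAtOfComplement {f : M → N}
    (hf : ContMDiff 𝓘(ℝ, E) 𝓘(ℝ, E') ∞ f) {x : M}
    (hinj : Function.Injective (mfderiv 𝓘(ℝ, E) 𝓘(ℝ, E') f x))
    (hdim : Module.finrank ℝ E + Module.finrank ℝ F = Module.finrank ℝ E') :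
    Manifold.IsImmersionAtOfComplement F 𝓘(ℝ, E) 𝓘(ℝ, E') ∞ f x := by
  let φ := chartAt E x
  let ψ := chartAt E' (f x)
  have hxφ : x ∈ φ.source := mem_chart_source E x
  have hxψ : f x ∈ ψ.source := mem_chart_source E' (f x)
  let U : Set E := φ.target ∩ φ.symm ⁻¹' (f ⁻¹' ψ.source)
  have hU : IsOpen U := φ.symm.isOpen_inter_preimage (ψ.open_source.preimage hf.continuous)
  have haU : φ x ∈ U := ⟨φ.map_source hxφ, by simpa [φ.left_inv hxφ] using hxψ⟩
  have hfU : ContDiffOn ℝ ∞ (ψ ∘ f ∘ φ.symm) U := by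
    rw [← contMDiffOn_iff_contDiffOn]
    exact contMDiffOn_chart.comp (hf.comp_contMDiffOn
      (contMDiffOn_chart_symm.mono Set.inter_subset_left)) fun u hu => hu.2
  have hfd : Function.Injective (fderiv ℝ (ψ ∘ f ∘ φ.symm) (φ x)) := by
    have := (hf.mdifferentiableAt (by simp) (x := x)).mfderiv
    simp only [writtenInExtChartAt, mfld_simps, fderivWithin_univ] at this
    rw [this] at hinj
    exact hinj
  obtain ⟨e, he⟩ := exists_continuousLinearEquiv_prod_extending hfd hdim
  obtain ⟨Θ, hΘa, hΘ, hΘs, hΘf⟩ := exists_openPartialHomeomorph_extending hU haU hfU e he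
  have hΘf' : ∀ y ∈ φ.source, Θ (e (φ y, 0)) = ψ (f y) := fun y hy => by
    rw [hΘf, Function.comp_apply, Function.comp_apply, φ.left_inv hy]
  obtain ⟨s, hs, hso, hxs⟩ : ∃ s : Set M, (∀ y ∈ s, y ∈ φ.source ∧ f y ∈ ψ.source ∧
      e (φ y, 0) ∈ Θ.source) ∧ IsOpen s ∧ x ∈ s := by
    refine eventually_nhds_iff.mp ?_
    have hc : ContinuousAt (fun y => e (φ y, 0)) x :=
      e.continuous.continuousAt.comp ((φ.continuousAt hxφ).prodMk continuousAt_const)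
    filter_upwards [φ.open_source.mem_nhds hxφ,
      hf.continuous.continuousAt (ψ.open_source.mem_nhds hxψ),
      hc (Θ.open_source.mem_nhds hΘa)] with y h1 h2 h3 using ⟨h1, h2, h3⟩
  -- Correcting the target chart by `Θ.symm` makes `f` read as the slice inclusion `u ↦ e (u, 0)`;
  -- the set `s` keeps the source chart where all compositions are defined.
  refine Manifold.IsImmersionAtOfComplement.mk_of_charts e (φ.restr s) (ψ.trans Θ.symm)
    ?_ ?_ ?_ ?_ ?_ ?_
  · simpa [hso.interior_eq] using ⟨hxφ, hxs⟩
  · refine ⟨hxψ, ?_⟩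
    change ψ (f x) ∈ Θ.target
    rw [← hΘf' x hxφ]
    exact Θ.map_source hΘa
  · exact restr_mem_maximalAtlas _ (IsManifold.chart_mem_maximalAtlas x) hso
  · refine OpenPartialHomeomorph.mem_maximalAtlas_of_contMDiffOn _ ?_ ?_
    · exact (contMDiffOn_iff_contDiffOn.mpr hΘs).comp
        (contMDiffOn_chart.mono Set.inter_subset_left) fun y hy => hy.2
    · exact contMDiffOn_chart_symm.comp
        ((contMDiffOn_iff_contDiffOn.mpr hΘ).mono Set.inter_subset_left) fun y hy => hy.2
  · intro y hy
    rw [φ.restr_source' s hso] at hy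
    obtain ⟨h1, h2, h3⟩ := hs y hy.2
    refine ⟨h2, ?_⟩
    change ψ (f y) ∈ Θ.target
    rw [← hΘf' y h1]
    exact Θ.map_source h3
  · intro u hu
    have hu' : u ∈ (φ.restr s).target := by simpa using hu
    have hy := (φ.restr s).map_target hu'
    rw [φ.restr_source' s hso] at hy
    obtain ⟨h1, h2, h3⟩ := hs _ hy.2
    have hu1 : φ (φ.symm u) = u := φ.right_inv hu'.1
    have h4 := hΘf' _ h1
    change e (φ (φ.symm u), 0) ∈ Θ.source at h3
    change Θ (e (φ (φ.symm u), 0)) = _ at h4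
    rw [hu1] at h3 h4
    change Θ.symm (ψ (f (φ.symm u))) = e (u, 0)
    exact (congrArg Θ.symm h4.symm).trans (Θ.left_inv h3)

end Immersion

/-! ### Dimension count, nonemptiness, and the unitary group as a Stiefel manifold -/

theorem stiefelDim_eq_stiefelDim_self_iff {N k : ℕ} (h : k ≤ N) :
    stiefelDim (Fin N) (Fin k) = stiefelDim (Fin N) (Fin N) ↔ k = N := by
  refine ⟨fun h' => ?_, fun h' => by rw [h']⟩
  obtain ⟨c, rfl⟩ := Nat.exists_eq_add_of_le h
  simp only [stiefelDim, Fintype.card_fin] at h'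
  -- With `N = k + c` the two dimensions differ by `c ^ 2`. Both are first rewritten without
  -- truncated subtraction.
  have h1 : 2 * (k + c) * k - k ^ 2 = k ^ 2 + 2 * k * c := Nat.sub_eq_of_eq_add (by ring)
  have h2 : 2 * (k + c) * (k + c) - (k + c) ^ 2 = (k + c) ^ 2 := Nat.sub_eq_of_eq_add (by ring)
  rw [h1, h2] at h'
  have : c ^ 2 = 0 := by nlinarith
  simpa using this

theorem channelFibre_nonempty {n m : ℕ} (Φ : QuantumChannel n m) : (channelFibre Φ).Nonempty := by
  obtain ⟨K, hK⟩ := Φ.completelyPositive.exists_krausSum_eq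
  exact ⟨⟨unblockMatrix (krausMatrix K), mem_stiefel_of_krausSum_eq Φ _ hK⟩,
    QuantumChannel.ext hK⟩

/-- The identification of the unitary group with the Stiefel manifold of square matrices is a
diffeomorphism. -/
noncomputable def unitaryDiffeomorph (ι : Type) [Fintype ι] [DecidableEq ι] :
    Matrix.unitaryGroup ι ℂ ≃ₘ^∞⟮𝓡 (stiefelDim ι ι), 𝓡 (stiefelDim ι ι)⟯ stiefel ι ι :=
  (unitaryHomeomorph ι).toDiffeomorphOfChartAtEq fun _ => rfl

/-! ### The fibre as an embedded submanifold -/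

section Fibre

variable {n m k : ℕ} {Φ : QuantumChannel n m} {K₀ : Fin k → Matrix (Fin m) (Fin n) ℂ}
  (hK₀ : krausSum K₀ = Φ.toLinearMap) (h : IsUnit (krausMatrix K₀ * (krausMatrix K₀)ᴴ).det)

/-- In matrix coordinates the inclusion is the parametrization of the fibre by `A`, followed by the
linear map `A ↦ A L`. -/
theorem contMDiff_channelFibre_val :
    letI := (channelFibreHomeomorph hK₀ h).pullbackChartedSpace
      (H := EuclideanSpace ℝ (Fin (stiefelDim (Fin (n * m)) (Fin k))))
    ContMDiff (𝓡 (stiefelDim (Fin (n * m)) (Fin k)))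
      (𝓡 (stiefelDim (Fin (n * m) × Fin m) (Fin n))) ∞
      (Subtype.val : channelFibre Φ → stiefel (Fin (n * m) × Fin m) (Fin n)) := by
  let _ := (channelFibreHomeomorph hK₀ h).pullbackChartedSpace
    (H := EuclideanSpace ℝ (Fin (stiefelDim (Fin (n * m)) (Fin k))))
  have _ : IsManifold (𝓡 (stiefelDim (Fin (n * m)) (Fin k))) ∞ (channelFibre Φ) :=
    (channelFibreHomeomorph hK₀ h).isManifold_pullback
  rw [contMDiff_stiefel_iff]
  have h1 := (contMDiff_stiefel_coe (ι := Fin (n * m)) (κ := Fin k)).comp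
    ((channelFibreHomeomorph hK₀ h).contMDiff_of_chartAt_eq
      (I := 𝓡 (stiefelDim (Fin (n * m)) (Fin k))) (r := ∞) fun _ => rfl).1
  let T : (Fin (n * m) → Fin k → ℂ) → (Fin (n * m) × Fin m) → Fin n → ℂ :=
    fun Z p b => ∑ j, Z p.1 j * krausMatrix K₀ j (p.2, b)
  have hT : ContDiff ℝ ∞ T := by
    refine contDiff_pi.mpr fun p => contDiff_pi.mpr fun b => ContDiff.sum fun j _ => ?_
    exact (contDiff_apply_apply ℝ ℂ p.1 j).mul contDiff_const
  refine (hT.contMDiff.comp h1).congr fun K => ?_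
  exact congrArg (fun K' : channelFibre Φ => K'.1.1)
    ((channelFibreHomeomorph hK₀ h).symm_apply_apply K).symm

/-- The chart of the fibre at `K` extends to a map `ρ` on the ambient manifold that is smooth at
`K`. By the chain rule the invertible differential of the chart factors through that of the
inclusion. -/
theorem injective_mfderiv_channelFibre_val (K : channelFibre Φ) :
    letI := (channelFibreHomeomorph hK₀ h).pullbackChartedSpace
      (H := EuclideanSpace ℝ (Fin (stiefelDim (Fin (n * m)) (Fin k))))
    Function.Injective (mfderiv (𝓡 (stiefelDim (Fin (n * m)) (Fin k)))
      (𝓡 (stiefelDim (Fin (n * m) × Fin m) (Fin n)))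
      (Subtype.val : channelFibre Φ → stiefel (Fin (n * m) × Fin m) (Fin n)) K) := by
  let _ := (channelFibreHomeomorph hK₀ h).pullbackChartedSpace
    (H := EuclideanSpace ℝ (Fin (stiefelDim (Fin (n * m)) (Fin k))))
  have _ : IsManifold (𝓡 (stiefelDim (Fin (n * m)) (Fin k))) ∞ (channelFibre Φ) :=
    (channelFibreHomeomorph hK₀ h).isManifold_pullback
  have _ : IsManifold (𝓡 (stiefelDim (Fin (n * m)) (Fin k))) 1 (channelFibre Φ) :=
    IsManifold.of_le (n := ∞) (by simp)
  let A := channelFibreHomeomorph hK₀ h K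
  let T : (Fin (n * m) × Fin m → Fin n → ℂ) → Fin (n * m) → Fin k → ℂ :=
    fun Z i j => ∑ p : Fin m × Fin n, Z (i, p.1) p.2 * krausRightInv K₀ p j
  have hT : ContDiff ℝ ∞ T := by
    refine contDiff_pi.mpr fun i => contDiff_pi.mpr fun j => ContDiff.sum fun p _ => ?_
    exact (contDiff_apply_apply ℝ ℂ (i, p.1) p.2).mul contDiff_const
  -- Off the fibre `T Z` need not have orthonormal columns; `ρ` still makes sense because the Cayley
  -- chart formula is defined on all matrices and is smooth near `A`.
  let ρ : stiefel (Fin (n * m) × Fin m) (Fin n) →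
      EuclideanSpace ℝ (Fin (stiefelDim (Fin (n * m)) (Fin k))) :=
    fun Z => stiefelChartFun A (T fun p b => Z.1 p b)
  have hρ : ContMDiffAt (𝓡 (stiefelDim (Fin (n * m) × Fin m) (Fin n)))
      (𝓡 (stiefelDim (Fin (n * m)) (Fin k))) ∞ ρ K.1 := by
    have h1 : ContMDiffAt 𝓘(ℝ, Fin (n * m) → Fin k → ℂ)
        𝓘(ℝ, EuclideanSpace ℝ (Fin (stiefelDim (Fin (n * m)) (Fin k)))) ∞
        (fun Z : Fin (n * m) → Fin k → ℂ => stiefelChartFun A Z) (T fun p b => K.1.1 p b) := by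
      let _ := Matrix.normedAddCommGroup (m := Fin (n * m)) (n := Fin k) (α := ℂ)
      let _ := Matrix.normedSpace (m := Fin (n * m)) (n := Fin k) (R := ℝ) (α := ℂ)
      exact ContDiffAt.contMDiffAt ((contDiffOn_stiefelChartFun A).contDiffAt
        ((isOpen_stiefelChartSource A).mem_nhds (mem_stiefelChart_source A)))
    exact ContMDiffAt.comp (f := fun Z : stiefel (Fin (n * m) × Fin m) (Fin n) =>
      T fun p b => Z.1 p b) K.1 h1 (hT.contMDiff.comp contMDiff_stiefel_coe).contMDiffAt
  have hval := contMDiff_channelFibre_val hK₀ h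
  have hcomp : ρ ∘ (Subtype.val : channelFibre Φ → _) =
      extChartAt (𝓡 (stiefelDim (Fin (n * m)) (Fin k))) K := rfl
  have hd := mfderiv_comp K (hρ.mdifferentiableAt (by simp))
    (hval.mdifferentiableAt (by simp) (x := K))
  rw [hcomp] at hd
  have hinv := isInvertible_mfderiv_extChartAt
    (I := 𝓡 (stiefelDim (Fin (n * m)) (Fin k))) (mem_extChartAt_source K)
  have hinj := hinv.injective
  rw [hd] at hinj
  exact Function.Injective.of_comp hinj

theorem isSmoothEmbedding_channelFibre_val :
    letI := (channelFibreHomeomorph hK₀ h).pullbackChartedSpace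
      (H := EuclideanSpace ℝ (Fin (stiefelDim (Fin (n * m)) (Fin k))))
    Manifold.IsSmoothEmbedding (𝓡 (stiefelDim (Fin (n * m)) (Fin k)))
      (𝓡 (stiefelDim (Fin (n * m) × Fin m) (Fin n))) ∞
      (Subtype.val : channelFibre Φ → stiefel (Fin (n * m) × Fin m) (Fin n)) := by
  let _ := (channelFibreHomeomorph hK₀ h).pullbackChartedSpace
    (H := EuclideanSpace ℝ (Fin (stiefelDim (Fin (n * m)) (Fin k))))
  have _ : IsManifold (𝓡 (stiefelDim (Fin (n * m)) (Fin k))) ∞ (channelFibre Φ) :=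
    (channelFibreHomeomorph hK₀ h).isManifold_pullback
  -- The complement has the codimension as its dimension; the truncated subtraction is exact because
  -- the injective differential forces the fibre to have the smaller dimension.
  refine ⟨Manifold.IsImmersionOfComplement.isImmersion
    (F := EuclideanSpace ℝ (Fin (stiefelDim (Fin (n * m) × Fin m) (Fin n) -
      stiefelDim (Fin (n * m)) (Fin k)))) fun K => ?_, Topology.IsEmbedding.subtypeVal⟩
  have hinj := injective_mfderiv_channelFibre_val hK₀ h K
  refine (contMDiff_channelFibre_val hK₀ h).isImmersionAtOfComplement hinj ?_
  have hle : Module.finrank ℝ (EuclideanSpace ℝ (Fin (stiefelDim (Fin (n * m)) (Fin k)))) ≤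
      Module.finrank ℝ (EuclideanSpace ℝ (Fin (stiefelDim (Fin (n * m) × Fin m) (Fin n)))) :=
    LinearMap.finrank_le_finrank_of_injective (f := ContinuousLinearMap.toLinearMap _) hinj
  simp only [finrank_euclideanSpace_fin] at hle ⊢
  omega

end Fibre

/-! ### The main theorem -/

theorem theorem2 (n m k : ℕ) (Φ : QuantumChannel n m) (hk : krausRank Φ = k) :
    (∀ K ∈ channelFibre Φ,
      channelFibre Φ = Set.range fun U : Matrix.unitaryGroup (Fin (n * m)) ℂ => unitaryAct U K) ∧
    ∃ (d : ℕ) (_ : ChartedSpace (EuclideanSpace ℝ (Fin d)) (channelFibre Φ)),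
      IsManifold (𝓡 d) ∞ (channelFibre Φ) ∧
      Manifold.IsSmoothEmbedding (𝓡 d) (𝓡 (stiefelDim (Fin (n * m) × Fin m) (Fin n))) ∞
        (Subtype.val : channelFibre Φ → stiefel (Fin (n * m) × Fin m) (Fin n)) ∧
      Nonempty (channelFibre Φ ≃ₘ^∞⟮𝓡 d, 𝓡 (stiefelDim (Fin (n * m)) (Fin k))⟯
        stiefel (Fin (n * m)) (Fin k)) ∧
      (Nonempty (channelFibre Φ ≃ₘ^∞⟮𝓡 d, 𝓡 (stiefelDim (Fin (n * m)) (Fin (n * m)))⟯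
        Matrix.unitaryGroup (Fin (n * m)) ℂ) ↔ k = n * m) := by
  refine ⟨fun K hK => channelFibre_eq_range_unitaryAct hK, ?_⟩
  obtain ⟨K₀, hK₀⟩ := exists_krausSum_eq_of_krausRank Φ
  have h := isUnit_det_gram_krausMatrix Φ K₀ hK₀
  have hle := krausRank_le Φ
  rw [hk] at hle
  subst hk
  let cs := (channelFibreHomeomorph hK₀ h).pullbackChartedSpace
    (H := EuclideanSpace ℝ (Fin (stiefelDim (Fin (n * m)) (Fin (krausRank Φ)))))
  have hM : IsManifold (𝓡 (stiefelDim (Fin (n * m)) (Fin (krausRank Φ)))) ∞ (channelFibre Φ) :=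
    (channelFibreHomeomorph hK₀ h).isManifold_pullback
  let D : channelFibre Φ ≃ₘ^∞⟮𝓡 (stiefelDim (Fin (n * m)) (Fin (krausRank Φ))),
      𝓡 (stiefelDim (Fin (n * m)) (Fin (krausRank Φ)))⟯
      stiefel (Fin (n * m)) (Fin (krausRank Φ)) :=
    (channelFibreHomeomorph hK₀ h).toDiffeomorphOfChartAtEq fun _ => rfl
  refine ⟨_, cs, hM, isSmoothEmbedding_channelFibre_val hK₀ h, ⟨D⟩, ?_, fun hk => ?_⟩
  · rintro ⟨e⟩
    -- Comparing dimensions through a differential needs a point of the fibre, which Choi's theorem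
    -- supplies.
    obtain ⟨K, hK⟩ := channelFibre_nonempty Φ
    rw [← stiefelDim_eq_stiefelDim_self_iff hle]
    have hfin : Module.finrank ℝ
        (EuclideanSpace ℝ (Fin (stiefelDim (Fin (n * m)) (Fin (krausRank Φ))))) =
        Module.finrank ℝ (EuclideanSpace ℝ (Fin (stiefelDim (Fin (n * m)) (Fin (n * m))))) :=
      (e.mfderivToContinuousLinearEquiv (by simp) (x := ⟨K, hK⟩)).toLinearEquiv.finrank_eq
    simpa only [finrank_euclideanSpace_fin] using hfin
  -- Neither side of `hk` is a variable. Generalizing only the index of the target Stiefel manifold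
  -- to `j` permits the substitution while the model space of the fibre stays fixed.
  · have hD : ∀ j, j = n * m → ∀ D : channelFibre Φ ≃ₘ^∞⟮𝓡 (stiefelDim (Fin (n * m))
        (Fin (krausRank Φ))), 𝓡 (stiefelDim (Fin (n * m)) (Fin j))⟯ stiefel (Fin (n * m)) (Fin j),
        Nonempty (channelFibre Φ ≃ₘ^∞⟮𝓡 (stiefelDim (Fin (n * m)) (Fin (krausRank Φ))),
          𝓡 (stiefelDim (Fin (n * m)) (Fin (n * m)))⟯ Matrix.unitaryGroup (Fin (n * m)) ℂ) := by
      rintro _ rfl D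
      exact ⟨D.trans (unitaryDiffeomorph _).symm⟩
    exact hD _ hk D
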